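/- **Setting.** For $l=1,2$ let $X_l\subset\mathbb R^{m_l}$ be compact and convex, $\|\cdot\|$ a norm on $\mathbb R^{m_l}$ with dual norm $\|\cdot\|_*$, $\mathcal V_l$ a nonempty set of $n_l$ agents, and $O_l\supseteq X_l$ an open set. Each agent $i\in\mathcal V_l$ has the cost $f_{l,i}(x_1,x_2)=\mathbb E[\Psi_{l,i}(x_1,x_2;\xi)]$, where $\xi$ is a random vector in $\mathbb R^d$ and the costs are defined for $x_l\in O_l$, $x_{3-l}\in X_{3-l}$. On $X_1\times X_2$, $f_{l,i}$ is continuous, convex in $x_l$ and concave in $x_{3-l}$, and $$U:=\frac1{n_1}\sum_{i}f_{1,i}=-\frac1{n_2}\sum_{j}f_{2,j}.$$ The subdifferential $\partial_l$ is taken in the variable $x_l$ over $O_l$: $g\in\partial h(p)$ iff $h(y)\ge h(p)+\langle g,y-p\rangle$ for all $y\in O_l$. Let $\psi_l$ be differentiable and $1$-strongly convex on $X_l$, $D_{\psi_l}(x,p)=\psi_l(x)-\psi_l(p)-\langle\nabla\psi_l(p),x-p\rangle$ and $P^l_x(y)=\arg\min_{x'\in X_l}\{\langle y,x-x'\rangle+D_{\psi_l}(x',x)\}$.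 *Communication.* There is $\kappa\in(0,1)$ such that for each $l$ the mixing matrices $W_l(t)=(w_{l,ij}(t))$ of digraphs $(\mathcal V_l,\mathcal E_l(t))$, $t\ge0$, are doubly stochastic (rows and columns sum to $1$), $w_{l,ij}(t)\ge\kappa$ if $(j,i)\in\mathcal E_l(t)$ and $w_{l,ij}(t)=0$ otherwise, $(i,i)\in\mathcal E_l(t)$ for all $i$, and for some integer $B_l\ge1$ the union of the graphs over any $B_l$ consecutive times is strongly connected. The weights $w_{12,ij}(t)\ge0$ ($i\in\mathcal V_l$, $j\in\mathcal V_{3-l}$) vanish unless $j$ is a neighbour of $i$ at time $t$ in the bipartite network that connects the two networks, and satisfy $\sum_jw_{12,ij}(t)=1$. *Algorithm (D-SMD) with step sizes $\alpha(t)$.* Start with $x_{l,i}(0)\in X_l$ (possibly random). For $t\ge0$, $l=1,2$, $i\in\mathcal V_l$, put $$v_{l,i}(t)=\sum_jw_{l,ij}(t)x_{l,j}(t),\qquad u_{3-l,i}(t)=\sum_jw_{12,ij}(t)x_{3-l,j}(t),$$ receive a sampled subgradient $\hat g_{l,i}(t)\in\partial_l\Psi_{l,i}(\cdot;\xi_{l,i}(t))$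 at $x_l=v_{l,i}(t)$, $x_{3-l}=u_{3-l,i}(t)$, where the $\xi_{l,i}(t)$ are independent copies of $\xi$, and set $x_{l,i}(t+1)=P^l_{v_{l,i}(t)}(-\alpha(t)\hat g_{l,i}(t))$. Let $\mathcal F_t=\sigma\{x_{l,i}(0),\xi_{l,i}(s):l=1,2,\ i\in\mathcal V_l,\ 0\le s\le t-1\}$; $\hat g_{l,i}(t)$ is $\mathcal F_{t+1}$-measurable. *Assumptions.* There are $L,\nu_1,\nu_2>0$ such that for all $l$, $i$, $t$: (A1) $|f_{l,i}(x_1,x_2)-f_{l,i}(x_1',x_2')|\le L(\|x_1-x_1'\|+\|x_2-x_2'\|)$ on $X_1\times X_2$, and for each fixed $x_{3-l}\in X_{3-l}$ the function $f_{l,i}$ is $L$-Lipschitz in $x_l\in O_l$. (A2) $\hat g_{l,i}(t)$ is integrable, $\mathbb E[\hat g_{l,i}(t)\mid\mathcal F_t]=g_{l,i}(t)$, where $g_{l,i}(t)$ is a subgradient in $\partial_lf_{l,i}$ at $x_l=v_{l,i}(t)$, $x_{3-l}=u_{3-l,i}(t)$, and $\|g_{l,i}(t)-\hat g_{l,i}(t)\|_*^2$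 is integrable with $\mathbb E[\|g_{l,i}(t)-\hat g_{l,i}(t)\|_*^2\mid\mathcal F_t]\le\nu_l^2$. (A3) $D_{\psi_l}(x,y)$ is convex in $y\in X_l$, and $x_k\to x$ in $X_l$ implies $D_{\psi_l}(x_k,x)\to0$. **Theorem.** Let $\eta>0$ and let each $f_{1,i}$ be $\eta$-strongly convex in $x_1\in X_1$ with respect to $\psi_1$ for every $x_2\in X_2$, i.e. $f_{1,i}(x,x_2)-f_{1,i}(y,x_2)-\langle\lambda,x-y\rangle\ge\eta D_{\psi_1}(x,y)$ for all $x,y\in X_1$ and $\lambda\in\partial_1f_{1,i}(y,x_2)$. Let $\alpha(t)=\frac1{\eta(t+1)}$. Then for every $i\in\mathcal V_1$ and every $T\ge1$ the pseudo regret $$\bar R_1^{(i)}(T)=\mathbb E\Big[\sum_{t=1}^TU(x_{1,i}(t),u_{2,i}(t))\Big]-\min_{x_1\in X_1}\mathbb E\Big[\sum_{t=1}^TU(x_1,u_{2,i}(t))\Big]$$ of D-SMD satisfies $$\bar R_1^{(i)}(T)\le\frac1\eta\sum_{l=1}^2(L+\nu_l)\Big(9L+\nu_l+\frac{4Ln_l\Gamma_l}{1-\theta_l}\Big)(1+\log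 T)+4L\sum_{l=1}^2\frac{n_l\Gamma_l\Lambda_l}{1-\theta_l},$$ where $\Gamma_l=(1-\kappa/4n_l^2)^{-2}$, $\theta_l=(1-\kappa/4n_l^2)^{1/B_l}$ and $\Lambda_l=\mathbb E[\max_{i\in\mathcal V_l}\|x_{l,i}(0)\|]$ (which is $\max_i\|x_{l,i}(0)\|$ for deterministic initial points). Consequently there is a constant $K$ with $\bar R_1^{(i)}(T)\le K\log T$ for all $i\in\mathcal V_1$ and all $T\ge2$. -/

import Mathlib

open MeasureTheory ProbabilityTheory Filter Topology

namespace DSMD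

section Convex

variable {E : Type*} [NormedAddCommGroup E] [NormedSpace ℝ E]

/-- The Bregman divergence `D_ψ(x, p) = ψ(x) - ψ(p) - ⟨∇ψ(p), x - p⟩` of a regularizer `ψ` that is
differentiable on the convex set `X`. For `x, p ∈ X` the value of a derivative of `ψ` within `X`
in the direction `x - p` is uniquely determined, even if `X` has empty interior. -/
noncomputable def bregman (X : Set E) (ψ : E → ℝ) (x p : E) : ℝ :=
  ψ x - ψ p - fderivWithin ℝ ψ X p (x - p)

/-- The subdifferential at `p` of a function `h` with domain `O`; subgradients live in the dual
space, whose operator norm is the dual norm. -/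
def subdiff (O : Set E) (h : E → ℝ) (p : E) : Set (StrongDual ℝ E) :=
  {g | ∀ y ∈ O, h p + g (y - p) ≤ h y}

/-- `q` is the value at `y` of the prox-mapping with base point `p`:
`q ∈ argmin_{x' ∈ X} ⟨y, p - x'⟩ + D_ψ(x', p)`. -/
def IsProx (X : Set E) (ψ : E → ℝ) (p : E) (y : StrongDual ℝ E) (q : E) : Prop :=
  q ∈ X ∧ IsMinOn (fun x' => y (p - x') + bregman X ψ x' p) X q

/-- `f` (with domain `O`) is `η`-strongly convex over `X` with respect to `ψ`. -/
def StronglyConvexWrt (O X : Set E) (ψ : E → ℝ) (η : ℝ) (f : E → ℝ) : Prop :=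
  ∀ x ∈ X, ∀ y ∈ X, ∀ lam ∈ subdiff O f y,
    η * bregman X ψ x y ≤ f x - f y - lam (x - y)

end Convex

section Mixing

/-- Mixing matrices `W t` of a directed graph sequence on `V`; `edge t j i` means that `(j, i)` is
an edge at time `t`, i.e. `i` receives information from `j`. -/
structure IsMixing {V : Type*} [Fintype V] (κ : ℝ) (B : ℕ) (edge : ℕ → V → V → Prop)
    (W : ℕ → Matrix V V ℝ) : Prop where
  weight_ge : ∀ t i j, edge t j i → κ ≤ W t i j
  weight_eq_zero : ∀ t i j, ¬ edge t j i → W t i j = 0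
  row_sum : ∀ t i, ∑ j, W t i j = 1
  col_sum : ∀ t j, ∑ i, W t i j = 1
  /-- every agent uses its own estimate -/
  self_loop : ∀ t i, edge t i i
  one_le : 1 ≤ B
  /-- the union graph over any `B` consecutive times is strongly connected -/
  strongly_connected : ∀ k i j,
    Relation.ReflTransGen (fun a b => ∃ t, k ≤ t ∧ t < k + B ∧ edge t a b) i j

/-- Weights `C t i j` with which agent `i ∈ V` averages the estimates that it receives from the
agents `j ∈ V'` of the other network. -/
structure IsCrossMixing {V V' : Type*} [Fintype V'] (edge : ℕ → V' → V → Prop)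
    (C : ℕ → Matrix V V' ℝ) : Prop where
  nonneg : ∀ t i j, 0 ≤ C t i j
  weight_eq_zero : ∀ t i j, ¬ edge t j i → C t i j = 0
  row_sum : ∀ t i, ∑ j, C t i j = 1

/-- `Γ = (1 - κ / (4 n²))⁻²`. -/
noncomputable def Gam (κ : ℝ) (n : ℕ) : ℝ := (1 - κ / (4 * (n : ℝ) ^ 2)) ^ (-2 : ℤ)

/-- `θ = (1 - κ / (4 n²))^(1/B)`. -/
noncomputable def theta (κ : ℝ) (n B : ℕ) : ℝ := (1 - κ / (4 * (n : ℝ) ^ 2)) ^ ((1 : ℝ) / (B : ℝ))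

end Mixing

/-- The data of one of the two networks: `E`, `V` are its decision space and its agents, `F`, `V'`
those of the opposing network. In all costs the network's own decision variable comes first. -/
structure Network (E F V V' : Type*) (d : ℕ) where
  /-- strategy set -/
  X : Set E
  /-- open neighbourhood of the strategy set on which the costs are defined as functions of the
  network's own variable, and with respect to which subgradients are taken -/
  O : Set E
  /-- sample costs: own decision, opposing decision, value of the random vector -/
  sample : V → E → F → (Fin d → ℝ) → ℝ
  /-- regularizer -/
  ψ : E → ℝ
  /-- edges inside the network -/
  edge : ℕ → V → V → Prop
  /-- mixing matrices inside the network -/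
  W : ℕ → Matrix V V ℝ
  /-- edges from the opposing network into this one -/
  crossEdge : ℕ → V' → V → Prop
  /-- mixing weights for the information from the opposing network -/
  C : ℕ → Matrix V V' ℝ

/-- The random objects of a run of the algorithm in one network, at time `t` and for agent `i`. -/
structure Run (Ω E V : Type*) [NormedAddCommGroup E] [NormedSpace ℝ E] (d : ℕ) where
  /-- estimates -/
  x : ℕ → V → Ω → E
  /-- samples of the random vector -/
  ξ : ℕ → V → Ω → (Fin d → ℝ)
  /-- sampled subgradients -/
  ghat : ℕ → V → Ω → StrongDual ℝ E
  /-- subgradients of the expected costs -/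
  g : ℕ → V → Ω → StrongDual ℝ E

section Game

variable {Ω : Type*} [MeasurableSpace Ω] {d : ℕ}
  {E F V V' : Type*} [NormedAddCommGroup E] [NormedSpace ℝ E]
  [NormedAddCommGroup F] [NormedSpace ℝ F] [Fintype V] [Fintype V']

/-- The expected cost `f_i(x, y) = 𝔼[sample_i(x, y; ξ)]` of agent `i`. -/
noncomputable def Network.cost (N : Network E F V V' d) (P : Measure Ω) (ξ : Ω → Fin d → ℝ)
    (i : V) (x : E) (y : F) : ℝ :=
  ∫ ω, N.sample i x y (ξ ω) ∂P

/-- The average `(1/n) ∑ f_i(x, y)` of the expected costs. -/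
noncomputable def Network.avgCost (N : Network E F V V' d) (P : Measure Ω) (ξ : Ω → Fin d → ℝ)
    (x : E) (y : F) : ℝ :=
  (1 / (Fintype.card V : ℝ)) * ∑ i, N.cost P ξ i x y

/-- Standing assumptions on one network; `X'` is the strategy set of the opposing network. -/
structure Network.IsValid (N : Network E F V V' d) (X' : Set F) (κ : ℝ) (B : ℕ)
    (P : Measure Ω) (ξ : Ω → Fin d → ℝ) : Prop where
  isCompact : IsCompact N.X
  convex : Convex ℝ N.X
  isOpen : IsOpen N.O
  subset : N.X ⊆ N.O
  integrable : ∀ i, ∀ x ∈ N.O, ∀ y ∈ X', Integrable (fun ω => N.sample i x y (ξ ω)) P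
  continuous_cost : ∀ i, ContinuousOn (fun z : E × F => N.cost P ξ i z.1 z.2) (N.X ×ˢ X')
  convex_cost : ∀ i, ∀ y ∈ X', ConvexOn ℝ N.X (fun x => N.cost P ξ i x y)
  concave_cost : ∀ i, ∀ x ∈ N.X, ConcaveOn ℝ X' (fun y => N.cost P ξ i x y)
  differentiable_reg : DifferentiableOn ℝ N.ψ N.X
  strongConvex_reg : StrongConvexOn N.X 1 N.ψ
  mixing : IsMixing κ B N.edge N.W
  crossMixing : IsCrossMixing N.crossEdge N.C

/-- Lipschitz continuity of the expected costs, on the product of the strategy sets and, in the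
network's own variable, on the neighbourhood `O` of its strategy set. -/
structure Network.LipschitzCosts (N : Network E F V V' d) (X' : Set F) (P : Measure Ω)
    (ξ : Ω → Fin d → ℝ) (L : ℝ) : Prop where
  lipschitz : ∀ i, ∀ x ∈ N.X, ∀ x' ∈ N.X, ∀ y ∈ X', ∀ y' ∈ X',
    |N.cost P ξ i x y - N.cost P ξ i x' y'| ≤ L * (‖x - x'‖ + ‖y - y'‖)
  lipschitz_own : ∀ i, ∀ x ∈ N.O, ∀ x' ∈ N.O, ∀ y ∈ X',
    |N.cost P ξ i x y - N.cost P ξ i x' y| ≤ L * ‖x - x'‖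

/-- The Bregman divergence is convex in its second argument and satisfies reciprocity. -/
structure Network.RegularDivergence (N : Network E F V V' d) : Prop where
  convex_right : ∀ x ∈ N.X, ConvexOn ℝ N.X (fun y => bregman N.X N.ψ x y)
  reciprocity : ∀ x ∈ N.X, ∀ s : ℕ → E, (∀ k, s k ∈ N.X) → Tendsto s atTop (𝓝 x) →
    Tendsto (fun k => bregman N.X N.ψ (s k) x) atTop (𝓝 0)

/-- `v_i(t) = ∑_j w_ij(t) x_j(t)`: average over the agent's own network. -/
def Network.v (N : Network E F V V' d) (R : Run Ω E V d) (t : ℕ) (i : V) (ω : Ω) : E :=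
  ∑ j, N.W t i j • R.x t j ω

/-- `u_i(t) = ∑_j w_{12,ij}(t) x'_j(t)`: the average that agent `i` of network `N` forms of the
estimates in the opposing network (whose run is `R'`). -/
def Network.u (N : Network E F V V' d) (R' : Run Ω F V' d) (t : ℕ) (i : V) (ω : Ω) : F :=
  ∑ j, N.C t i j • R'.x t j ω

/-- The information `ℱ_t = σ{x_{l,i}(0), ξ_{l,i}(s) : l = 1,2, i ∈ V_l, 0 ≤ s ≤ t - 1}`. -/
@[reducible] def past [MeasurableSpace E] [MeasurableSpace F] (R : Run Ω E V d) (R' : Run Ω F V' d) (t : ℕ) :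
    MeasurableSpace Ω :=
  (⨆ i, MeasurableSpace.comap (R.x 0 i) inferInstance) ⊔
  (⨆ i, MeasurableSpace.comap (R'.x 0 i) inferInstance) ⊔
  (⨆ s ∈ Set.Iio t, ⨆ i, MeasurableSpace.comap (R.ξ s i) inferInstance) ⊔
  (⨆ s ∈ Set.Iio t, ⨆ i, MeasurableSpace.comap (R'.ξ s i) inferInstance)

/-- The part of the algorithm that is carried out in one network, with step sizes `α`; `ℱ` is the
information flow. -/
structure Network.Follows (N : Network E F V V' d) [MeasurableSpace E] (ℱ : ℕ → MeasurableSpace Ω)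
    (R : Run Ω E V d) (R' : Run Ω F V' d) (α : ℕ → ℝ) : Prop where
  measurable_init : ∀ i, Measurable (R.x 0 i)
  init_mem : ∀ i ω, R.x 0 i ω ∈ N.X
  /-- the sampled subgradient at time `t` is determined by the samples up to time `t` -/
  measurable_ghat : ∀ t i, Measurable[ℱ (t + 1)] (R.ghat t i)
  ghat_mem : ∀ t i ω, R.ghat t i ω ∈
    subdiff N.O (fun x => N.sample i x (N.u R' t i ω) (R.ξ t i ω)) (N.v R t i ω)
  update : ∀ t i ω, IsProx N.X N.ψ (N.v R t i ω) (-(α t • R.ghat t i ω)) (R.x (t + 1) i ω)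

/-- The sampled subgradients are conditionally unbiased estimates of subgradients of the expected
costs, with conditional second moment of the error at most `ν²`. -/
structure Network.UnbiasedOracle (N : Network E F V V' d) (P : Measure Ω) (ξ : Ω → Fin d → ℝ)
    (ℱ : ℕ → MeasurableSpace Ω) (R : Run Ω E V d) (R' : Run Ω F V' d) (ν : ℝ) : Prop where
  g_mem : ∀ t i, ∀ᵐ ω ∂P, R.g t i ω ∈
    subdiff N.O (fun x => N.cost P ξ i x (N.u R' t i ω)) (N.v R t i ω)
  integrable : ∀ t i, Integrable (R.ghat t i) P
  unbiased : ∀ t i, P[R.ghat t i | ℱ t] =ᵐ[P] R.g t i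
  integrable_sq : ∀ t i, Integrable (fun ω => ‖R.g t i ω - R.ghat t i ω‖ ^ 2) P
  variance_le : ∀ t i,
    ∀ᵐ ω ∂P, (P[fun ω' => ‖R.g t i ω' - R.ghat t i ω'‖ ^ 2 | ℱ t]) ω ≤ ν ^ 2

/-- All samples drawn in the two networks are independent copies of `ξ`. -/
structure IsIIDSample (P : Measure Ω) (ξ : Ω → Fin d → ℝ) (R : Run Ω E V d) (R' : Run Ω F V' d) :
    Prop where
  measurable : ∀ t i, Measurable (R.ξ t i)
  measurable' : ∀ t i, Measurable (R'.ξ t i)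
  indep : iIndepFun (fun k : ℕ × (V ⊕ V') => Sum.elim (R.ξ k.1) (R'.ξ k.1) k.2) P
  identDistrib : ∀ t i, IdentDistrib (R.ξ t i) ξ P P
  identDistrib' : ∀ t i, IdentDistrib (R'.ξ t i) ξ P P

/-- The pseudo regret of network `N` associated with agent `i`, cumulated up to time `T`. (The
infimum over the compact strategy set is a minimum.) -/
noncomputable def pseudoRegret (N : Network E F V V' d) (P : Measure Ω) (ξ : Ω → Fin d → ℝ)
    (R : Run Ω E V d) (R' : Run Ω F V' d) (i : V) (T : ℕ) : ℝ :=
  (∫ ω, ∑ t ∈ Finset.Icc 1 T, N.avgCost P ξ (R.x t i ω) (N.u R' t i ω) ∂P) -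
    sInf ((fun x => ∫ ω, ∑ t ∈ Finset.Icc 1 T, N.avgCost P ξ x (N.u R' t i ω) ∂P) '' N.X)

/-- `Λ = 𝔼[max_i ‖x_i(0)‖]`, which is `max_i ‖x_i(0)‖` for deterministic initial estimates. -/
noncomputable def Lam (P : Measure Ω) (R : Run Ω E V d) : ℝ :=
  ∫ ω, ⨆ i, ‖R.x 0 i ω‖ ∂P

end Game

/-- The step sizes `α(t) = 1 / (η (t + 1))`. -/
noncomputable def stepSize (η : ℝ) (t : ℕ) : ℝ := 1 / (η * ((t : ℝ) + 1))

/-- The contribution `(L + ν) (9 L + ν + 4 L n Γ / (1 - θ))` of a network to the factor of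
`(1 + log T)`. -/
noncomputable def logCoeff (L ν κ : ℝ) (n B : ℕ) : ℝ :=
  (L + ν) * (9 * L + ν + 4 * L * n * Gam κ n / (1 - theta κ n B))

/-- The contribution `n Γ Λ / (1 - θ)` of a network to the constant term. -/
noncomputable def constCoeff (Λ κ : ℝ) (n B : ℕ) : ℝ :=
  n * Gam κ n * Λ / (1 - theta κ n B)

end DSMD

/-!
A mirror descent step compares the estimate with a fixed point `x` through the Bregman divergence
`D(x, ·)`. Strong convexity with respect to `D` gains `η D(x, v(t))` at time `t`, and with step
sizes `1 / (η (t + 1))` this is exactly what makes the weighted divergences telescope, while the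
convexity of `D(x, ·)` and double stochasticity keep the averaging of the estimates from increasing
`∑ i, D(x, v_i)`. What remains is `∑ t, α(t) ‖ĝ(t)‖² / 2`, which grows like `log T / η`, a noise
term of mean zero given the past, and the price of the disagreement among the agents.

The disagreement is controlled by the variance of the estimates. Over a window of length `B` the
union of the graphs is strongly connected, so that across each gap of the sorted values some agent
averages with weight at least `κ`; this contracts the variance by the factor `1 - κ / (2 n²)`. Hence
perturbations of total size `p(s)` at time `s` contribute at most `Γ θ ^ (t - 1 - s) p(s)` to the
disagreement at time `t`, and summing the geometric series leaves once more a multiple of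
`∑ t, α(t)`.
-/

namespace DSMD

section Convex

variable {E : Type*} [NormedAddCommGroup E] [NormedSpace ℝ E] {O X : Set E} {ψ : E → ℝ}

theorem norm_le_of_mem_subdiff {h : E → ℝ} {p : E} {L : ℝ} (hO : O ∈ 𝓝 p) (hL : 0 ≤ L)
    (hLip : ∀ x ∈ O, |h x - h p| ≤ L * ‖x - p‖) {g : StrongDual ℝ E} (hg : g ∈ subdiff O h p) :
    ‖g‖ ≤ L := by
  obtain ⟨ε, hε, hball⟩ := Metric.mem_nhds_iff.1 hO
  have apply_le : ∀ z : E, ‖z‖ < ε → g z ≤ L * ‖z‖ := by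
    intro z hz
    have hy : p + z ∈ O := hball (by simpa [dist_eq_norm] using hz)
    have hsub := hg _ hy
    have hdiff := (abs_le.1 (hLip _ hy)).2
    rw [add_sub_cancel_left] at hsub hdiff
    linarith
  refine ContinuousLinearMap.opNorm_le_of_ball hε hL fun z hz => abs_le.2 ⟨?_, ?_⟩
  · have := apply_le (-z) (by simpa using hz)
    rw [map_neg, norm_neg] at this
    linarith
  · exact apply_le z (by simpa using hz)

theorem tendsto_slope_segment (hX : Convex ℝ X) {x p : E} (hψ : DifferentiableWithinAt ℝ ψ X p)
    (hx : x ∈ X) (hp : p ∈ X) :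
    Tendsto (fun s : ℝ => s⁻¹ * (ψ (p + s • (x - p)) - ψ p)) (𝓝[>] 0)
      (𝓝 (fderivWithin ℝ ψ X p (x - p))) := by
  refine hψ.hasFDerivWithinAt.lim (v := x - p) ?_ ?_ ?_
  · have : Tendsto (fun s : ℝ => s • (x - p)) (𝓝 0) (𝓝 ((0 : ℝ) • (x - p))) :=
      tendsto_id.smul_const _
    rw [zero_smul] at this
    exact this.mono_left nhdsWithin_le_nhds
  · filter_upwards [Ioc_mem_nhdsGT zero_lt_one] with s hs
    exact hX.add_smul_sub_mem hp hx ⟨hs.1.le, hs.2⟩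
  · refine tendsto_const_nhds.congr' ?_
    filter_upwards [self_mem_nhdsWithin] with s (hs : 0 < s)
    rw [inv_smul_smul₀ hs.ne']

theorem bregman_self (X : Set E) (ψ : E → ℝ) (x : E) : bregman X ψ x x = 0 := by
  simp [bregman]

theorem mul_sq_norm_le_bregman {m : ℝ} (hψ : StrongConvexOn X m ψ) {x p : E}
    (hdiff : DifferentiableWithinAt ℝ ψ X p) (hx : x ∈ X) (hp : p ∈ X) :
    m / 2 * ‖x - p‖ ^ 2 ≤ bregman X ψ x p := by
  have slope_le : ∀ᶠ s : ℝ in 𝓝[>] 0, s⁻¹ * (ψ (p + s • (x - p)) - ψ p) ≤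
      ψ x - ψ p - (1 - s) * (m / 2 * ‖x - p‖ ^ 2) := by
    filter_upwards [Ioc_mem_nhdsGT zero_lt_one] with s hs
    have hconv := hψ.2 hx hp hs.1.le (sub_nonneg.2 hs.2) (by ring)
    rw [show s • x + (1 - s) • p = p + s • (x - p) by module] at hconv
    simp only [smul_eq_mul] at hconv
    rw [inv_mul_le_iff₀ hs.1]
    linarith
  have hlim : Tendsto (fun s : ℝ => ψ x - ψ p - (1 - s) * (m / 2 * ‖x - p‖ ^ 2)) (𝓝[>] 0)
      (𝓝 (ψ x - ψ p - (1 - 0) * (m / 2 * ‖x - p‖ ^ 2))) :=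
    (Continuous.tendsto (by fun_prop) 0).mono_left nhdsWithin_le_nhds
  have := le_of_tendsto_of_tendsto (tendsto_slope_segment hψ.1 hdiff hx hp) hlim slope_le
  unfold bregman
  linarith

theorem half_sq_le_bregman (hdiff : DifferentiableOn ℝ ψ X) (hψ : StrongConvexOn X 1 ψ) {x p : E}
    (hx : x ∈ X) (hp : p ∈ X) : ‖x - p‖ ^ 2 / 2 ≤ bregman X ψ x p := by
  have := mul_sq_norm_le_bregman hψ (hdiff p hp) hx hp
  linarith

theorem bregman_nonneg (hdiff : DifferentiableOn ℝ ψ X) (hψ : StrongConvexOn X 1 ψ) {x p : E}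
    (hx : x ∈ X) (hp : p ∈ X) : 0 ≤ bregman X ψ x p :=
  le_trans (by positivity) (half_sq_le_bregman hdiff hψ hx hp)

theorem abs_apply_sub_le (g : StrongDual ℝ E) (x y : E) : |g (x - y)| ≤ ‖g‖ * ‖x - y‖ :=
  g.le_opNorm (x - y)

namespace IsProx

variable {p q x : E} {y : StrongDual ℝ E}

theorem three_point (hX : Convex ℝ X) (hψ : DifferentiableOn ℝ ψ X) (hq : IsProx X ψ p y q)
    (hx : x ∈ X) : bregman X ψ q p + bregman X ψ x q + y (x - q) ≤ bregman X ψ x p := by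
  have hderiv : HasFDerivWithinAt (fun x' => y (p - x') + bregman X ψ x' p)
      (-y + (fderivWithin ℝ ψ X q - fderivWithin ℝ ψ X p)) X q := by
    have hψq := (hψ q hq.1).hasFDerivWithinAt
    have hid := hasFDerivWithinAt_id (𝕜 := ℝ) q X
    refine ((y.hasFDerivAt.comp_hasFDerivWithinAt q (hid.const_sub p)).add
      ((hψq.sub_const (ψ p)).sub ((fderivWithin ℝ ψ X p).hasFDerivAt.comp_hasFDerivWithinAt q
        (hid.sub_const p)))).congr_fderiv ?_
    ext z
    simp
  have hfirst := hq.2.localize.hasFDerivWithinAt_nonneg hderiv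
    (sub_mem_posTangentConeAt_of_segment_subset (hX.segment_subset hq.1 hx))
  simp only [bregman, map_sub, add_apply, neg_apply, sub_apply] at hfirst ⊢
  linarith

theorem descent {g : StrongDual ℝ E} {α : ℝ} (hq : IsProx X ψ p (-(α • g)) q)
    (hdiff : DifferentiableOn ℝ ψ X) (hψ : StrongConvexOn X 1 ψ) (hp : p ∈ X) (hx : x ∈ X) :
    α * g (p - x) ≤ bregman X ψ x p - bregman X ψ x q + α ^ 2 * ‖g‖ ^ 2 / 2 := by
  have hthree := hq.three_point hψ.1 hdiff hx
  have hbreg := half_sq_le_bregman hdiff hψ hq.1 hp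
  have happly : α * g (p - q) ≤ ‖α • g‖ * ‖p - q‖ := by
    simpa using (abs_le.1 (abs_apply_sub_le (α • g) p q)).2
  have hyoung := two_mul_le_add_sq ‖α • g‖ ‖p - q‖
  have hnorm : ‖α • g‖ ^ 2 = α ^ 2 * ‖g‖ ^ 2 := by rw [norm_smul, mul_pow, Real.norm_eq_abs, sq_abs]
  rw [norm_sub_rev q p] at hbreg
  simp only [neg_apply, smul_apply, smul_eq_mul, map_sub] at hthree happly ⊢
  linarith

theorem quadratic_growth (hq : IsProx X ψ p y q) (hdiff : DifferentiableOn ℝ ψ X)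
    (hψ : StrongConvexOn X 1 ψ) (hx : x ∈ X) :
    y (p - q) + bregman X ψ q p + ‖x - q‖ ^ 2 / 2 ≤ y (p - x) + bregman X ψ x p := by
  have hthree := hq.three_point hψ.1 hdiff hx
  have hbreg := half_sq_le_bregman hdiff hψ hx hq.1
  simp only [map_sub] at hthree ⊢
  linarith

theorem norm_sub_le (hq : IsProx X ψ p y q) (hdiff : DifferentiableOn ℝ ψ X)
    (hψ : StrongConvexOn X 1 ψ) (hp : p ∈ X) : ‖q - p‖ ≤ ‖y‖ := by
  have hthree := hq.three_point hψ.1 hdiff hp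
  have hqp := half_sq_le_bregman hdiff hψ hq.1 hp
  have hpq := half_sq_le_bregman hdiff hψ hp hq.1
  have happly := (abs_le.1 (abs_apply_sub_le y p q)).1
  rw [bregman_self] at hthree
  rw [norm_sub_rev p q] at hpq happly
  have hsq : ‖q - p‖ * ‖q - p‖ ≤ ‖y‖ * ‖q - p‖ := by linarith
  rcases (norm_nonneg (q - p)).eq_or_lt with h0 | hpos
  · exact h0 ▸ norm_nonneg y
  · exact le_of_mul_le_mul_right hsq hpos

end IsProx

theorem StronglyConvexWrt.norm_sub_le {f : E → ℝ} {η L : ℝ} (hf : StronglyConvexWrt O X ψ η f)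
    (hη : 0 < η) (hdiff : DifferentiableOn ℝ ψ X) (hψ : StrongConvexOn X 1 ψ) {x p : E}
    (hx : x ∈ X) (hp : p ∈ X) (hLip : |f x - f p| ≤ L * ‖x - p‖) {g : StrongDual ℝ E}
    (hg : g ∈ subdiff O f p) (hgL : ‖g‖ ≤ L) : ‖x - p‖ ≤ 4 * L / η := by
  have hstrong := hf x hx p hp g hg
  have hbreg := mul_le_mul_of_nonneg_left (half_sq_le_bregman hdiff hψ hx hp) hη.le
  have hcost := (abs_le.1 hLip).2
  have happly := (abs_le.1 (abs_apply_sub_le g x p)).1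
  have hgnorm := mul_le_mul_of_nonneg_right hgL (norm_nonneg (x - p))
  have hsq : ‖x - p‖ * η * ‖x - p‖ ≤ 4 * L * ‖x - p‖ := by linarith
  rw [le_div_iff₀ hη]
  rcases (norm_nonneg (x - p)).eq_or_lt with h0 | hpos
  · have := (norm_nonneg g).trans hgL
    rw [← h0]
    linarith
  · exact le_of_mul_le_mul_right hsq hpos

end Convex

section Measurability

variable {Ω : Type*} {m : MeasurableSpace Ω} {E : Type*} [NormedAddCommGroup E] {X : Set E}

theorem measurable_comp_of_continuousOn {E G : Type*} [TopologicalSpace E] [MeasurableSpace E]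
    [OpensMeasurableSpace E] [TopologicalSpace G] [MeasurableSpace G] [BorelSpace G]
    {f : E → G} {s : Set E} (hf : ContinuousOn f s) {u : Ω → E} (hu : Measurable u)
    (hus : ∀ ω, u ω ∈ s) : Measurable fun ω => f (u ω) :=
  (continuousOn_iff_continuous_domRestrict.1 hf).measurable.comp (hu.subtype_mk (h := hus))

section Argmin

variable [SecondCountableTopology E] {F : Ω → E → ℝ} {q : Ω → E}

theorem measurable_min (hmeas : ∀ x ∈ X, Measurable fun ω => F ω x)
    (hcont : ∀ ω, ContinuousOn (F ω) X) (hqX : ∀ ω, q ω ∈ X)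
    (hq : ∀ ω, IsMinOn (F ω) X (q ω)) : Measurable fun ω => F ω (q ω) := by
  rcases isEmpty_or_nonempty Ω with hΩ | ⟨⟨ω₀⟩⟩
  · exact measurable_of_empty _
  have : Nonempty X := ⟨⟨q ω₀, hqX ω₀⟩⟩
  let s : ℕ → X := TopologicalSpace.denseSeq X
  have hs : DenseRange s := TopologicalSpace.denseRange_denseSeq X
  refine Measurable.isGLB (fun k => hmeas (s k) (s k).2) fun ω => ⟨?_, fun c hc => ?_⟩
  · rintro _ ⟨k, rfl⟩
    exact isMinOn_iff.1 (hq ω) _ (s k).2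
  · have hclosed : IsClosed {x : X | c ≤ F ω x} :=
      isClosed_le continuous_const (continuousOn_iff_continuous_domRestrict.1 (hcont ω))
    exact hs.induction_on (p := fun x : X => c ≤ F ω x) ⟨q ω, hqX ω⟩ hclosed
      fun k => hc ⟨k, rfl⟩

variable [MeasurableSpace E] [BorelSpace E]

theorem measurable_argmin (hmeas : ∀ x ∈ X, Measurable fun ω => F ω x)
    (hcont : ∀ ω, ContinuousOn (F ω) X) (hqX : ∀ ω, q ω ∈ X)
    (hq : ∀ ω, ∀ x ∈ X, F ω (q ω) + ‖x - q ω‖ ^ 2 / 2 ≤ F ω x) :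
    Measurable q := by
  classical
  rcases isEmpty_or_nonempty Ω with hΩ | ⟨⟨ω₀⟩⟩
  · exact measurable_of_empty _
  have : Nonempty X := ⟨⟨q ω₀, hqX ω₀⟩⟩
  let s : ℕ → X := TopologicalSpace.denseSeq X
  have hs : DenseRange s := TopologicalSpace.denseRange_denseSeq X
  have hisMin : ∀ ω, IsMinOn (F ω) X (q ω) := fun ω => isMinOn_iff.2 fun x hx => by
    have : 0 ≤ ‖x - q ω‖ ^ 2 / 2 := by positivity
    linarith [hq ω x hx]
  have hmin := measurable_min hmeas hcont hqX hisMin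
  -- By quadratic growth, near-minimizers chosen measurably from a dense sequence converge to `q`.
  have exists_near : ∀ (n : ℕ) ω, ∃ k, F ω (s k) < F ω (q ω) + 1 / ((n : ℝ) + 1) := fun n ω => by
    have hopen : IsOpen {x : X | F ω x < F ω (q ω) + 1 / ((n : ℝ) + 1)} :=
      isOpen_lt (continuousOn_iff_continuous_domRestrict.1 (hcont ω)) continuous_const
    have hlt : F ω (q ω) < F ω (q ω) + 1 / ((n : ℝ) + 1) := lt_add_of_pos_right _ (by positivity)
    exact hs.exists_mem_open hopen ⟨⟨q ω, hqX ω⟩, hlt⟩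
  let near : ℕ → Ω → E := fun n ω => s (Nat.find (exists_near n ω))
  have measurable_near : ∀ n, Measurable (near n) := fun n =>
    (measurable_from_nat (f := fun k => ((s k : X) : E))).comp <| measurable_find _ fun k =>
      measurableSet_lt (hmeas _ (s k).2) (hmin.add_const _)
  refine measurable_of_tendsto_metrizable measurable_near (tendsto_pi_nhds.2 fun ω => ?_)
  have hbound : ∀ n : ℕ, ‖near n ω - q ω‖ ^ 2 ≤ 2 * (1 / ((n : ℝ) + 1)) := fun n => by
    have hgrowth := hq ω (near n ω) (s _).2
    have hnear : F ω (near n ω) < F ω (q ω) + 1 / ((n : ℝ) + 1) := Nat.find_spec (exists_near n ω)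
    linarith
  have hlim : Tendsto (fun n => ‖near n ω - q ω‖ ^ 2) atTop (𝓝 0) :=
    squeeze_zero (fun _ => by positivity) hbound
      (by simpa using (tendsto_one_div_add_atTop_nhds_zero_nat (𝕜 := ℝ)).const_mul 2)
  rw [tendsto_iff_norm_sub_tendsto_zero]
  simpa using hlim.sqrt

end Argmin

variable [NormedSpace ℝ E] [FiniteDimensional ℝ E] [MeasurableSpace E] [BorelSpace E]
  {ψ : E → ℝ} {p : Ω → E}

theorem measurable_bregman (hX : Convex ℝ X) (hψ : DifferentiableOn ℝ ψ X) {x : E} (hx : x ∈ X)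
    (hp : Measurable p) (hpX : ∀ ω, p ω ∈ X) : Measurable fun ω => bregman X ψ x (p ω) := by
  have := FiniteDimensional.proper ℝ E
  have hψp := measurable_comp_of_continuousOn hψ.continuousOn hp hpX
  let s : ℕ → ℝ := fun n => 1 / ((n : ℝ) + 1)
  have hs : Tendsto s atTop (𝓝[>] 0) :=
    tendsto_nhdsWithin_iff.2 ⟨tendsto_one_div_add_atTop_nhds_zero_nat,
      Eventually.of_forall fun n => Set.mem_Ioi.2 (Nat.one_div_pos_of_nat (n := n))⟩
  have measurable_slope : ∀ n,
      Measurable fun ω => (s n)⁻¹ * (ψ (p ω + s n • (x - p ω)) - ψ (p ω)) := fun n =>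
    ((measurable_comp_of_continuousOn hψ.continuousOn (by fun_prop) fun ω =>
      hX.add_smul_sub_mem (hpX ω) hx ⟨Nat.one_div_pos_of_nat.le,
        (div_le_one (by positivity)).2 (by simp)⟩).sub hψp).const_mul _
  exact (hψp.const_sub _).sub <| measurable_of_tendsto_metrizable measurable_slope <|
    tendsto_pi_nhds.2 fun ω => (tendsto_slope_segment hX (hψ _ (hpX ω)) hx (hpX ω)).comp hs

theorem measurable_clm_apply {g : Ω → StrongDual ℝ E} {w : Ω → E} (hg : Measurable g)
    (hw : Measurable w) : Measurable fun ω => g ω (w ω) := by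
  have := FiniteDimensional.proper ℝ E
  exact (isBoundedBilinearMap_apply (𝕜 := ℝ) (E := E) (F := ℝ)).continuous.measurable.comp
    (hg.prodMk hw)

theorem measurable_prox (hdiff : DifferentiableOn ℝ ψ X) (hψ : StrongConvexOn X 1 ψ)
    (hp : Measurable p) (hpX : ∀ ω, p ω ∈ X) {y : Ω → StrongDual ℝ E} (hy : Measurable y)
    {q : Ω → E} (hq : ∀ ω, IsProx X ψ (p ω) (y ω) (q ω)) : Measurable q := by
  have := FiniteDimensional.proper ℝ E
  refine measurable_argmin (X := X) (F := fun ω x => y ω (p ω - x) + bregman X ψ x (p ω))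
    (fun x hx => ?_) (fun ω => ?_) (fun ω => (hq ω).1)
    fun ω x hx => (hq ω).quadratic_growth hdiff hψ hx
  · exact (measurable_clm_apply hy (hp.sub_const x)).add (measurable_bregman hψ.1 hdiff hx hp hpX)
  · have := hdiff.continuousOn
    unfold bregman
    fun_prop

end Measurability

section Variance

variable {V : Type*} [Fintype V] {M : Matrix V V ℝ}

/-- The weighted variance of the values `z` under the weights in row `k` of the row-stochastic
matrix `M`: the part of the sum of squares of `z` that averaging with `M` destroys at `k`. -/
def rowVariance (M : Matrix V V ℝ) (z : V → ℝ) (k : V) : ℝ :=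
  ∑ i, M k i * (z i - M.mulVec z k) ^ 2

theorem rowVariance_nonneg (hM : ∀ i j, 0 ≤ M i j) (z : V → ℝ) (k : V) : 0 ≤ rowVariance M z k :=
  Finset.sum_nonneg fun i _ => mul_nonneg (hM k i) (sq_nonneg _)

theorem rowVariance_eq {k : V} (hrow : ∑ j, M k j = 1) (z : V → ℝ) :
    rowVariance M z k = ∑ i, M k i * z i ^ 2 - M.mulVec z k ^ 2 := by
  have hmean : ∑ i, M k i * z i = M.mulVec z k := rfl
  calc rowVariance M z k
      = ∑ i, M k i * z i ^ 2 - 2 * M.mulVec z k * ∑ i, M k i * z i +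
          M.mulVec z k ^ 2 * ∑ i, M k i := by
        rw [Finset.mul_sum, Finset.mul_sum, ← Finset.sum_sub_distrib, ← Finset.sum_add_distrib]
        exact Finset.sum_congr rfl fun i _ => by ring
    _ = _ := by rw [hmean, hrow]; ring

theorem sum_sq_mulVec_add_sum_rowVariance [DecidableEq V] (hM : M ∈ doublyStochastic ℝ V)
    (z : V → ℝ) : ∑ k, M.mulVec z k ^ 2 + ∑ k, rowVariance M z k = ∑ i, z i ^ 2 := by
  simp only [rowVariance_eq (sum_row_of_mem_doublyStochastic hM _), Finset.sum_sub_distrib]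
  rw [Finset.sum_comm]
  simp only [← Finset.sum_mul, sum_col_of_mem_doublyStochastic hM, one_mul]
  ring

theorem half_mul_sq_sub_le_rowVariance (hM : ∀ i j, 0 ≤ M i j) {κ : ℝ} (hκ : 0 ≤ κ) {i j k : V}
    (hi : κ ≤ M k i) (hj : κ ≤ M k j) (z : V → ℝ) :
    κ / 2 * (z i - z j) ^ 2 ≤ rowVariance M z k := by
  classical
  by_cases hij : i = j
  · simpa [hij] using rowVariance_nonneg hM z k
  set c := M.mulVec z k
  calc κ / 2 * (z i - z j) ^ 2 ≤ κ * (z i - c) ^ 2 + κ * (z j - c) ^ 2 := by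
        nlinarith [mul_nonneg hκ (sq_nonneg (z i + z j - 2 * c))]
    _ ≤ M k i * (z i - c) ^ 2 + M k j * (z j - c) ^ 2 := by gcongr
    _ = ∑ l ∈ {i, j}, M k l * (z l - c) ^ 2 := by rw [Finset.sum_pair hij]
    _ ≤ rowVariance M z k := Finset.sum_le_sum_of_subset_of_nonneg (Finset.subset_univ _)
        fun l _ _ => mul_nonneg (hM k l) (sq_nonneg _)

theorem mulVec_le_of_forall_le {z : V → ℝ} {i : V} {c : ℝ} (hnonneg : ∀ j, 0 ≤ M i j)
    (hrow : ∑ j, M i j = 1) (hz : ∀ j, M i j ≠ 0 → z j ≤ c) : M.mulVec z i ≤ c := by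
  calc M.mulVec z i ≤ ∑ j, M i j * c := Finset.sum_le_sum fun j _ => by
        rcases eq_or_ne (M i j) 0 with h | h
        · simp [h]
        · exact mul_le_mul_of_nonneg_left (hz j h) (hnonneg j)
    _ = c := by rw [← Finset.sum_mul, hrow, one_mul]

theorem le_mulVec_of_forall_le {z : V → ℝ} {i : V} {c : ℝ} (hnonneg : ∀ j, 0 ≤ M i j)
    (hrow : ∑ j, M i j = 1) (hz : ∀ j, M i j ≠ 0 → c ≤ z j) : c ≤ M.mulVec z i := by
  have := mulVec_le_of_forall_le (z := -z) hnonneg hrow fun j hj => neg_le_neg (hz j hj)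
  rw [Matrix.mulVec_neg] at this
  exact neg_le_neg_iff.1 this

end Variance

section Gaps

theorem sum_sq_le_sum_sq_sub {V : Type*} [Fintype V] {z : V → ℝ} (hz : ∑ i, z i = 0) (c : ℝ) :
    ∑ i, z i ^ 2 ≤ ∑ i, (z i - c) ^ 2 := by
  have hexpand : ∑ i, (z i - c) ^ 2 = ∑ i, z i ^ 2 - 2 * c * ∑ i, z i + ∑ _i : V, c ^ 2 := by
    rw [Finset.mul_sum, ← Finset.sum_sub_distrib, ← Finset.sum_add_distrib]
    exact Finset.sum_congr rfl fun i _ => by ring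
  have : 0 ≤ ∑ _i : V, c ^ 2 := Finset.sum_nonneg fun _ _ => sq_nonneg c
  rw [hexpand, hz]
  linarith

theorem exists_monotone_enumeration {V : Type*} [Fintype V] [Nonempty V] (z : V → ℝ) :
    ∃ (r : V ≃ Fin (Fintype.card V)) (y : ℕ → ℝ), Monotone y ∧ ∀ v, z v = y (r v) := by
  let e₀ : Fin (Fintype.card V) ≃ V := (Fintype.equivFin V).symm
  let e := (Tuple.sort (z ∘ e₀)).trans e₀
  have hmono : Monotone (z ∘ e) := Tuple.monotone_sort (z ∘ e₀)
  have hpos : 0 < Fintype.card V := Fintype.card_pos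
  refine ⟨e.symm, fun d => z (e ⟨min d (Fintype.card V - 1), by omega⟩),
    fun a b hab => hmono (Fin.mk_le_mk.2 (by omega)), fun v => ?_⟩
  have hmin : min (e.symm v).1 (Fintype.card V - 1) = (e.symm v).1 := by omega
  simp only [hmin, Fin.eta, Equiv.apply_symm_apply]

theorem sq_sub_le_mul_sum_sq_gaps (y : ℕ → ℝ) {k n : ℕ} (hk : k < n) :
    (y k - y 0) ^ 2 ≤ n * ∑ d ∈ Finset.range (n - 1), (y (d + 1) - y d) ^ 2 := by
  rw [← Finset.sum_range_sub]
  refine sq_sum_le_card_mul_sum_sq.trans ?_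
  rw [Finset.card_range]
  gcongr
  omega

theorem sum_sq_le_card_sq_mul_sum_sq_gaps {V : Type*} [Fintype V] {z : V → ℝ}
    (hz : ∑ i, z i = 0) {n : ℕ} {r : V → Fin n} {y : ℕ → ℝ} (hy : ∀ v, z v = y (r v)) :
    ∑ i, z i ^ 2 ≤
      Fintype.card V * (n * ∑ d ∈ Finset.range (n - 1), (y (d + 1) - y d) ^ 2) := by
  refine (sum_sq_le_sum_sq_sub hz (y 0)).trans ?_
  rw [← nsmul_eq_mul, ← Finset.card_univ]
  exact Finset.sum_le_card_nsmul _ _ _ fun i _ => by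
    rw [hy]
    exact sq_sub_le_mul_sum_sq_gaps y (r i).2

theorem sum_sq_gaps_le {y : ℕ → ℝ} (hy : Monotone y) {D : Finset ℕ} (hD : D.Nonempty) :
    ∑ d ∈ D, (y (d + 1) - y d) ^ 2 ≤ (y (D.max' hD + 1) - y (D.min' hD)) ^ 2 := by
  have gap_nonneg : ∀ d, 0 ≤ y (d + 1) - y d := fun d => sub_nonneg.2 (hy (Nat.le_succ d))
  have hle : D.min' hD ≤ D.max' hD + 1 := (D.min'_le_max' hD).trans (Nat.le_succ _)
  have hsum : ∑ d ∈ D, (y (d + 1) - y d) ≤ y (D.max' hD + 1) - y (D.min' hD) :=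
    calc ∑ d ∈ D, (y (d + 1) - y d)
        ≤ ∑ d ∈ Finset.Ico (D.min' hD) (D.max' hD + 1), (y (d + 1) - y d) :=
          Finset.sum_le_sum_of_subset_of_nonneg (fun d hd => Finset.mem_Ico.2
            ⟨D.min'_le d hd, Nat.lt_succ_of_le (D.le_max' d hd)⟩) fun d _ _ => gap_nonneg d
      _ = y (D.max' hD + 1) - y (D.min' hD) := Finset.sum_Ico_sub y hle
  exact (Finset.sum_sq_le_sq_sum_of_nonneg fun d _ => gap_nonneg d).trans
    (pow_le_pow_left₀ (Finset.sum_nonneg fun d _ => gap_nonneg d) hsum 2)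

theorem mul_sum_sq_gaps_le_sum {ι : Type*} {y : ℕ → ℝ} (hy : Monotone y) {c : ℝ} (hc : 0 ≤ c)
    {D : Finset ℕ} {A : Finset ι} {p : ℕ → ι} (hp : ∀ d ∈ D, p d ∈ A) {ℓ : ι → ℝ}
    (hnonneg : ∀ a ∈ A, 0 ≤ ℓ a)
    (hℓ : ∀ d ∈ D, ∀ d' ∈ D, d ≤ d' → p d = p d' → c * (y (d' + 1) - y d) ^ 2 ≤ ℓ (p d)) :
    c * ∑ d ∈ D, (y (d + 1) - y d) ^ 2 ≤ ∑ a ∈ A, ℓ a := by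
  classical
  rw [← Finset.sum_fiberwise_of_maps_to hp, Finset.mul_sum]
  refine Finset.sum_le_sum fun a ha => ?_
  rcases (D.filter (p · = a)).eq_empty_or_nonempty with hempty | hne
  · simpa [hempty] using hnonneg a ha
  obtain ⟨hmin, hpmin⟩ := Finset.mem_filter.1 (Finset.min'_mem _ hne)
  obtain ⟨hmax, hpmax⟩ := Finset.mem_filter.1 (Finset.max'_mem _ hne)
  have := hℓ _ hmin _ hmax (Finset.min'_le_max' _ hne) (hpmin.trans hpmax.symm)
  rw [hpmin] at this
  exact (mul_le_mul_of_nonneg_left (sum_sq_gaps_le hy hne) hc).trans this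

end Gaps

section Consensus

variable {V : Type*} [Fintype V] {κ : ℝ} {B : ℕ} {edge : ℕ → V → V → Prop}
  {W : ℕ → Matrix V V ℝ}

namespace IsMixing

theorem nonneg (h : IsMixing κ B edge W) (hκ : 0 ≤ κ) (t : ℕ) (i j : V) : 0 ≤ W t i j := by
  by_cases he : edge t j i
  · exact hκ.trans (h.weight_ge t i j he)
  · exact (h.weight_eq_zero t i j he).ge

theorem mem_doublyStochastic [DecidableEq V] (h : IsMixing κ B edge W) (hκ : 0 ≤ κ) (t : ℕ) :
    W t ∈ doublyStochastic ℝ V :=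
  mem_doublyStochastic_iff_sum.2 ⟨h.nonneg hκ t, h.row_sum t, h.col_sum t⟩

theorem shift (h : IsMixing κ B edge W) (s : ℕ) :
    IsMixing κ B (fun t => edge (s + t)) (fun t => W (s + t)) where
  weight_ge t := h.weight_ge _
  weight_eq_zero t := h.weight_eq_zero _
  row_sum t := h.row_sum _
  col_sum t := h.col_sum _
  self_loop t := h.self_loop _
  one_le := h.one_le
  strongly_connected k i j := by
    refine Relation.ReflTransGen.mono ?_ i j (h.strongly_connected (s + k) i j)
    rintro a b ⟨t, hkt, htB, hedge⟩
    exact ⟨t - s, by omega, by omega, by rwa [Nat.add_sub_cancel' (by omega)]⟩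

end IsMixing

theorem exists_crossing_of_reflTransGen {V : Type*} {r : V → V → Prop} {S : Set V} {i j : V}
    (h : Relation.ReflTransGen r i j) (hi : i ∈ S) (hj : j ∉ S) :
    ∃ a b, r a b ∧ ¬(a ∈ S ↔ b ∈ S) := by
  by_contra! hno
  have : j ∈ S := by
    induction h with
    | refl => exact hi
    | tail _ hbc ih => exact (hno _ _ hbc).1 (by_contra fun hb => hj.elim (by tauto))
  exact hj this

end Consensus

section Consensus

variable {V : Type*} [Fintype V] {κ : ℝ} {B : ℕ} {edge : ℕ → V → V → Prop}
  {W : ℕ → Matrix V V ℝ} {z : ℕ → V → ℝ}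

namespace IsMixing

theorem exists_crossing_edge (h : IsMixing κ B edge W) {S : Set V} {i j : V} (hi : i ∈ S)
    (hj : j ∉ S) : ∃ t < B, ∃ a b, edge t a b ∧ ¬(a ∈ S ↔ b ∈ S) := by
  obtain ⟨a, b, ⟨t, -, ht, hab⟩, hne⟩ :=
    exists_crossing_of_reflTransGen (h.strongly_connected 0 i j) hi hj
  exact ⟨t, by omega, a, b, hab, hne⟩

theorem bounds_of_no_crossing (h : IsMixing κ B edge W) (hκ : 0 ≤ κ)
    (hz : ∀ t, z (t + 1) = (W t).mulVec (z t)) {S : Set V} {lo hi : ℝ}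
    (hhi : ∀ i ∈ S, hi ≤ z 0 i) (hlo : ∀ i ∉ S, z 0 i ≤ lo) {T : ℕ}
    (hT : ∀ t < T, ∀ a b, edge t a b → (a ∈ S ↔ b ∈ S)) :
    (∀ i ∈ S, hi ≤ z T i) ∧ ∀ i ∉ S, z T i ≤ lo := by
  induction T with
  | zero => exact ⟨hhi, hlo⟩
  | succ t ih =>
    obtain ⟨ih_hi, ih_lo⟩ := ih fun s hs => hT s (by omega)
    have same_side : ∀ i j, W t i j ≠ 0 → (j ∈ S ↔ i ∈ S) := fun i j hij =>
      hT t (Nat.lt_succ_self t) j i (not_imp_comm.1 (h.weight_eq_zero t i j) hij)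
    rw [hz]
    exact ⟨fun i hi => le_mulVec_of_forall_le (h.nonneg hκ t i) (h.row_sum t i)
        fun j hj => ih_hi j ((same_side i j hj).2 hi),
      fun i hi => mulVec_le_of_forall_le (h.nonneg hκ t i) (h.row_sum t i)
        fun j hj => ih_lo j (mt (same_side i j hj).1 hi)⟩

-- Until the first communication across the cut the two sides stay separated; the receiving agent
-- of that communication also hears itself, and so averages values from both sides.
theorem exists_cut_bridge (h : IsMixing κ B edge W) (hκ : 0 ≤ κ)
    (hz : ∀ t, z (t + 1) = (W t).mulVec (z t)) {S : Set V} {i₀ j₀ : V} (hi₀ : i₀ ∈ S)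
    (hj₀ : j₀ ∉ S) {lo hi : ℝ} (hhi : ∀ i ∈ S, hi ≤ z 0 i) (hlo : ∀ i ∉ S, z 0 i ≤ lo) :
    ∃ t < B, ∃ k i j, edge t i k ∧ edge t j k ∧ z t i ≤ lo ∧ hi ≤ z t j := by
  classical
  obtain ⟨s, hs, hcross⟩ := h.exists_crossing_edge hi₀ hj₀
  have hex : ∃ t, ∃ a b, edge t a b ∧ ¬(a ∈ S ↔ b ∈ S) := ⟨s, hcross⟩
  have hlt : Nat.find hex < B := (Nat.find_min' hex hcross).trans_lt hs
  obtain ⟨above, below⟩ := h.bounds_of_no_crossing hκ hz hhi hlo (T := Nat.find hex)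
    fun t ht a b hab => by_contra fun hne => Nat.find_min hex ht ⟨a, b, hab, hne⟩
  obtain ⟨a, b, hab, hne⟩ := Nat.find_spec hex
  by_cases ha : a ∈ S
  · exact ⟨_, hlt, b, b, a, h.self_loop _ _, hab, below b (by tauto), above a ha⟩
  · exact ⟨_, hlt, b, a, b, hab, h.self_loop _ _, below a ha, above b (by tauto)⟩

theorem exists_gap_bridge (h : IsMixing κ B edge W) (hκ : 0 ≤ κ)
    (hz : ∀ t, z (t + 1) = (W t).mulVec (z t)) {n : ℕ} (r : V ≃ Fin n) {y : ℕ → ℝ}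
    (hy : Monotone y) (hr : ∀ v, z 0 v = y (r v)) {d : ℕ} (hd : d + 1 < n) :
    ∃ p : ℕ × V, p.1 < B ∧ ∃ i j, edge p.1 i p.2 ∧ edge p.1 j p.2 ∧
      z p.1 i ≤ y d ∧ y (d + 1) ≤ z p.1 j := by
  obtain ⟨t, ht, k, bridge⟩ := h.exists_cut_bridge hκ hz (S := {v | d + 1 ≤ (r v).1})
    (i₀ := r.symm ⟨d + 1, hd⟩) (j₀ := r.symm ⟨d, by omega⟩) (by simp) (by simp)
    (fun i hi => (hr i).symm ▸ hy hi)
    (fun i hi => (hr i).symm ▸ hy (Nat.le_of_lt_succ (not_le.1 hi)))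
  exact ⟨(t, k), ht, bridge⟩

theorem half_mul_sum_sq_gaps_le [Nonempty V] (h : IsMixing κ B edge W) (hκ : 0 ≤ κ)
    (hz : ∀ t, z (t + 1) = (W t).mulVec (z t)) {n : ℕ} (r : V ≃ Fin n) {y : ℕ → ℝ}
    (hy : Monotone y) (hr : ∀ v, z 0 v = y (r v)) :
    κ / 2 * ∑ d ∈ Finset.range (n - 1), (y (d + 1) - y d) ^ 2 ≤
      ∑ t ∈ Finset.range B, ∑ k, rowVariance (W t) (z t) k := by
  have bridge := fun d (hd : d ∈ Finset.range (n - 1)) =>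
    h.exists_gap_bridge hκ hz r hy hr (d := d) (by have := Finset.mem_range.1 hd; omega)
  choose! p hpB hp using bridge
  rw [← Finset.sum_product']
  refine mul_sum_sq_gaps_le_sum hy (by positivity) (p := p)
    (fun d hd => Finset.mem_product.2 ⟨Finset.mem_range.2 (hpB d hd), Finset.mem_univ _⟩)
    (fun a _ => rowVariance_nonneg (h.nonneg hκ a.1) _ _) fun d hd d' hd' hdd' hpp => ?_
  obtain ⟨i, -, hi, -, hzi, -⟩ := hp d hd
  obtain ⟨-, j, -, hj, -, hzj⟩ := hp d' hd'
  rw [← hpp] at hj hzj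
  have hgap : 0 ≤ y (d' + 1) - y d := sub_nonneg.2 (hy (by omega))
  calc κ / 2 * (y (d' + 1) - y d) ^ 2 ≤ κ / 2 * (z (p d).1 j - z (p d).1 i) ^ 2 := by gcongr
    _ ≤ rowVariance (W (p d).1) (z (p d).1) (p d).2 :=
      half_mul_sq_sub_le_rowVariance (h.nonneg hκ _) hκ (h.weight_ge _ _ _ hj)
        (h.weight_ge _ _ _ hi) _

theorem sum_sq_succ_add_sum_rowVariance (h : IsMixing κ B edge W) (hκ : 0 ≤ κ)
    (hz : ∀ t, z (t + 1) = (W t).mulVec (z t)) (t : ℕ) :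
    ∑ i, z (t + 1) i ^ 2 + ∑ k, rowVariance (W t) (z t) k = ∑ i, z t i ^ 2 := by
  classical
  rw [hz]
  exact sum_sq_mulVec_add_sum_rowVariance (h.mem_doublyStochastic hκ t) (z t)

theorem sum_sq_add_sum_rowVariance (h : IsMixing κ B edge W) (hκ : 0 ≤ κ)
    (hz : ∀ t, z (t + 1) = (W t).mulVec (z t)) (T : ℕ) :
    ∑ i, z T i ^ 2 + ∑ t ∈ Finset.range T, ∑ k, rowVariance (W t) (z t) k = ∑ i, z 0 i ^ 2 := by
  induction T with
  | zero => simp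
  | succ T ih =>
    rw [Finset.sum_range_succ, ← ih, ← h.sum_sq_succ_add_sum_rowVariance hκ hz T]
    ring

theorem antitone_sum_sq (h : IsMixing κ B edge W) (hκ : 0 ≤ κ)
    (hz : ∀ t, z (t + 1) = (W t).mulVec (z t)) : Antitone fun t => ∑ i, z t i ^ 2 :=
  antitone_nat_of_succ_le fun t => by
    have hloss : 0 ≤ ∑ k, rowVariance (W t) (z t) k :=
      Finset.sum_nonneg fun k _ => rowVariance_nonneg (h.nonneg hκ t) _ _
    linarith [h.sum_sq_succ_add_sum_rowVariance hκ hz t]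

theorem sum_eq_zero (h : IsMixing κ B edge W)
    (hz : ∀ t, z (t + 1) = (W t).mulVec (z t)) (hsum : ∑ i, z 0 i = 0) (t : ℕ) :
    ∑ i, z t i = 0 := by
  induction t with
  | zero => exact hsum
  | succ t ih =>
    rw [hz, ← ih]
    simp only [Matrix.mulVec, dotProduct]
    rw [Finset.sum_comm]
    simp only [← Finset.sum_mul, h.col_sum, one_mul]

theorem sum_sq_le [Nonempty V] (h : IsMixing κ B edge W) (hκ : 0 ≤ κ)
    (hz : ∀ t, z (t + 1) = (W t).mulVec (z t)) (hsum : ∑ i, z 0 i = 0) :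
    ∑ i, z B i ^ 2 ≤ (1 - κ / (2 * (Fintype.card V : ℝ) ^ 2)) * ∑ i, z 0 i ^ 2 := by
  obtain ⟨r, y, hy, hr⟩ := exists_monotone_enumeration (z 0)
  have hloss := h.half_mul_sum_sq_gaps_le hκ hz r hy hr
  have hspread := sum_sq_le_card_sq_mul_sum_sq_gaps hsum hr
  set n := Fintype.card V
  set G := ∑ d ∈ Finset.range (n - 1), (y (d + 1) - y d) ^ 2
  have hn : (0 : ℝ) < n := by exact_mod_cast Fintype.card_pos
  have hfrac : κ / (2 * (n : ℝ) ^ 2) * ∑ i, z 0 i ^ 2 ≤ κ / 2 * G :=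
    calc κ / (2 * (n : ℝ) ^ 2) * ∑ i, z 0 i ^ 2 ≤ κ / (2 * (n : ℝ) ^ 2) * (n * (n * G)) := by
          gcongr
      _ = κ / 2 * G := by field_simp
  linarith [h.sum_sq_add_sum_rowVariance hκ hz B]

end IsMixing

end Consensus

section Rates

/-- The factor `1 - κ / (4 n²)` by which the Euclidean norm of the disagreement among `n` agents
contracts over one period of joint connectivity: `Γ` and `θ` are powers of it. -/
noncomputable def contractionFactor (κ : ℝ) (n : ℕ) : ℝ := 1 - κ / (4 * (n : ℝ) ^ 2)

theorem one_sub_le_sq_contractionFactor (κ : ℝ) (n : ℕ) :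
    1 - κ / (2 * (n : ℝ) ^ 2) ≤ contractionFactor κ n ^ 2 := by
  have hhalf : κ / (2 * (n : ℝ) ^ 2) = 2 * (κ / (4 * (n : ℝ) ^ 2)) := by ring
  unfold contractionFactor
  rw [hhalf]
  nlinarith [sq_nonneg (κ / (4 * (n : ℝ) ^ 2))]

variable {κ : ℝ} {n B : ℕ}

theorem contractionFactor_pos (hκ : κ < 1) (hn : n ≠ 0) : 0 < contractionFactor κ n := by
  have hn1 : (1 : ℝ) ≤ (n : ℝ) ^ 2 := one_le_pow₀ (by exact_mod_cast Nat.one_le_iff_ne_zero.2 hn)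
  have : κ / (4 * (n : ℝ) ^ 2) < 1 := (div_lt_one (by positivity)).2 (by linarith)
  unfold contractionFactor
  linarith

theorem contractionFactor_lt_one (hκ : 0 < κ) (hn : n ≠ 0) : contractionFactor κ n < 1 :=
  sub_lt_self _ (by positivity)

theorem theta_pos (hκ : κ < 1) (hn : n ≠ 0) : 0 < theta κ n B :=
  Real.rpow_pos_of_pos (contractionFactor_pos hκ hn) _

theorem theta_lt_one (hκ₀ : 0 < κ) (hκ₁ : κ < 1) (hn : n ≠ 0) (hB : 1 ≤ B) : theta κ n B < 1 :=
  Real.rpow_lt_one (contractionFactor_pos hκ₁ hn).le (contractionFactor_lt_one hκ₀ hn)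
    (one_div_pos.2 (by exact_mod_cast hB))

theorem Gam_pos (hκ : κ < 1) (hn : n ≠ 0) : 0 < Gam κ n :=
  zpow_pos (contractionFactor_pos hκ hn) _

theorem contractionFactor_pow_div_le (hκ₀ : 0 < κ) (hκ₁ : κ < 1) (hn : n ≠ 0) (hB : 1 ≤ B)
    (t : ℕ) : contractionFactor κ n ^ (t / B) ≤ Gam κ n * theta κ n B ^ t := by
  have hq := contractionFactor_pos hκ₁ hn
  have hB0 : (0 : ℝ) < B := by exact_mod_cast hB
  change _ ≤ contractionFactor κ n ^ (-2 : ℤ) * (contractionFactor κ n ^ ((1 : ℝ) / B)) ^ t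
  rw [← Real.rpow_natCast, ← Real.rpow_natCast, ← Real.rpow_intCast, ← Real.rpow_mul hq.le,
    ← Real.rpow_add hq]
  refine Real.rpow_le_rpow_of_exponent_ge hq (contractionFactor_lt_one hκ₀ hn).le ?_
  have hdiv : (t : ℝ) / B < ((t / B : ℕ) : ℝ) + 1 := by
    rw [div_lt_iff₀ hB0]
    exact_mod_cast Nat.lt_mul_of_div_lt (Nat.lt_succ_self (t / B)) hB
  push_cast
  rw [one_div_mul_eq_div]
  linarith

end Rates

section Transition

variable {V : Type*} [Fintype V] {κ : ℝ} {B : ℕ} {edge : ℕ → V → V → Prop}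
  {W : ℕ → Matrix V V ℝ}

namespace IsMixing

theorem sum_sq_le_pow [Nonempty V] (h : IsMixing κ B edge W) (hκ : 0 ≤ κ) {z : ℕ → V → ℝ}
    (hz : ∀ t, z (t + 1) = (W t).mulVec (z t)) (hsum : ∑ i, z 0 i = 0) (m : ℕ) :
    ∑ i, z (B * m) i ^ 2 ≤
      (contractionFactor κ (Fintype.card V) ^ m) ^ 2 * ∑ i, z 0 i ^ 2 := by
  induction m with
  | zero => simp
  | succ m ih =>
    set q := contractionFactor κ (Fintype.card V)
    have hwindow := (h.shift (B * m)).sum_sq_le hκ (z := fun t => z (B * m + t))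
      (fun t => hz (B * m + t)) (h.sum_eq_zero hz hsum _)
    calc ∑ i, z (B * (m + 1)) i ^ 2
        ≤ (1 - κ / (2 * (Fintype.card V : ℝ) ^ 2)) * ∑ i, z (B * m) i ^ 2 := hwindow
      _ ≤ q ^ 2 * ∑ i, z (B * m) i ^ 2 := by
        gcongr
        exact one_sub_le_sq_contractionFactor κ _
      _ ≤ q ^ 2 * ((q ^ m) ^ 2 * ∑ i, z 0 i ^ 2) := by gcongr
      _ = (q ^ (m + 1)) ^ 2 * ∑ i, z 0 i ^ 2 := by ring

theorem abs_le_of_sum_sq_le_one (h : IsMixing κ B edge W) (hκ₀ : 0 < κ) (hκ₁ : κ < 1)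
    {z : ℕ → V → ℝ} (hz : ∀ t, z (t + 1) = (W t).mulVec (z t)) (hsum : ∑ i, z 0 i = 0)
    (hsq : ∑ i, z 0 i ^ 2 ≤ 1) (t : ℕ) (i : V) :
    |z t i| ≤ Gam κ (Fintype.card V) * theta κ (Fintype.card V) B ^ t := by
  have : Nonempty V := ⟨i⟩
  set q := contractionFactor κ (Fintype.card V)
  have hq : 0 < q := contractionFactor_pos hκ₁ Fintype.card_ne_zero
  refine (abs_le_of_sq_le_sq ?_ (pow_nonneg hq.le (t / B))).trans
    (contractionFactor_pow_div_le hκ₀ hκ₁ Fintype.card_ne_zero h.one_le t)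
  calc z t i ^ 2 ≤ ∑ k, z t k ^ 2 :=
        Finset.single_le_sum (f := fun k => z t k ^ 2) (fun k _ => sq_nonneg _) (Finset.mem_univ i)
    _ ≤ ∑ k, z (B * (t / B)) k ^ 2 := h.antitone_sum_sq hκ₀.le hz (Nat.mul_div_le t B)
    _ ≤ (q ^ (t / B)) ^ 2 * ∑ k, z 0 k ^ 2 := h.sum_sq_le_pow hκ₀.le hz hsum _
    _ ≤ (q ^ (t / B)) ^ 2 := mul_le_of_le_one_right (sq_nonneg _) hsq

end IsMixing

theorem sum_sq_ite_sub_one_div_card_le_one [DecidableEq V] (j : V) :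
    ∑ k : V, ((if k = j then (1 : ℝ) else 0) - 1 / Fintype.card V : ℝ) ^ 2 ≤ 1 := by
  have : Nonempty V := ⟨j⟩
  have hn : (Fintype.card V : ℝ) ≠ 0 := Nat.cast_ne_zero.2 Fintype.card_ne_zero
  calc ∑ k : V, ((if k = j then (1 : ℝ) else 0) - 1 / Fintype.card V : ℝ) ^ 2
      = ∑ k : V, ((if k = j then 1 - 2 / (Fintype.card V : ℝ) else 0) +
          (1 / Fintype.card V) ^ 2 : ℝ) :=
        Finset.sum_congr rfl fun k _ => by split_ifs <;> ring
    _ = (1 - 1 / Fintype.card V : ℝ) := by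
        rw [Finset.sum_add_distrib, Finset.sum_ite_eq', if_pos (Finset.mem_univ j),
          Finset.sum_const, Finset.card_univ, nsmul_eq_mul]
        field_simp
        ring
    _ ≤ 1 := sub_le_self _ (by positivity)

/-- The product `W (s + k - 1) ⋯ W (s + 1) W s` of `k` consecutive mixing matrices, which carries
the values at time `s` to those at time `s + k`. -/
def transition [DecidableEq V] (W : ℕ → Matrix V V ℝ) (s : ℕ) : ℕ → Matrix V V ℝ
  | 0 => 1
  | k + 1 => W (s + k) * transition W s k

theorem IsMixing.abs_transition_sub_le [DecidableEq V] (h : IsMixing κ B edge W) (hκ₀ : 0 < κ)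
    (hκ₁ : κ < 1) (s t : ℕ) (i j : V) : |transition W s t i j - 1 / (Fintype.card V : ℝ)| ≤
      Gam κ (Fintype.card V) * theta κ (Fintype.card V) B ^ t := by
  have : Nonempty V := ⟨i⟩
  let z : ℕ → V → ℝ := fun t k => transition W s t k j - 1 / (Fintype.card V : ℝ)
  have hz : ∀ t, z (t + 1) = (W (s + t)).mulVec (z t) := fun t => by
    ext k
    simp only [z, transition, Matrix.mul_apply, Matrix.mulVec, dotProduct, mul_sub,
      Finset.sum_sub_distrib, ← Finset.sum_mul, h.row_sum, one_mul]
  have hz₀ : z 0 = fun k => (if k = j then (1 : ℝ) else 0) - 1 / Fintype.card V := by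
    ext k
    simp only [z, transition, Matrix.one_apply]
  refine (h.shift s).abs_le_of_sum_sq_le_one hκ₀ hκ₁ hz ?_ ?_ t i
  · simp [hz₀]
  · rw [hz₀]
    exact sum_sq_ite_sub_one_div_card_le_one j

variable {E : Type*} [NormedAddCommGroup E] [NormedSpace ℝ E]

theorem sum_smul_sum_smul (M N : Matrix V V ℝ) (y : V → E) (i : V) :
    ∑ k, M i k • ∑ j, N k j • y j = ∑ j, (M * N) i j • y j := by
  simp only [Matrix.mul_apply, Finset.smul_sum, Finset.sum_smul, smul_smul]
  exact Finset.sum_comm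

theorem eq_sum_transition [DecidableEq V] {x e : ℕ → V → E}
    (hx : ∀ t i, x (t + 1) i = ∑ j, W t i j • x t j + e t i) (t : ℕ) (i : V) :
    x t i = ∑ j, transition W 0 t i j • x 0 j +
      ∑ s ∈ Finset.range t, ∑ j, transition W (s + 1) (t - 1 - s) i j • e s j := by
  induction t generalizing i with
  | zero => simp [transition, Matrix.one_apply]
  | succ t ih =>
    have hinit : ∑ k, W t i k • ∑ j, transition W 0 t k j • x 0 j =
        ∑ j, transition W 0 (t + 1) i j • x 0 j := by
      rw [sum_smul_sum_smul, transition, Nat.zero_add]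
    have hpast : ∑ k, W t i k •
          ∑ s ∈ Finset.range t, ∑ j, transition W (s + 1) (t - 1 - s) k j • e s j =
        ∑ s ∈ Finset.range t, ∑ j, transition W (s + 1) (t - s) i j • e s j := by
      simp only [Finset.smul_sum (s := Finset.range t)]
      rw [Finset.sum_comm]
      refine Finset.sum_congr rfl fun s hs => ?_
      have hst : s < t := Finset.mem_range.1 hs
      rw [sum_smul_sum_smul, show t - s = (t - 1 - s) + 1 by omega, transition,
        show s + 1 + (t - 1 - s) = t by omega]
    have hnew : ∑ j, transition W (t + 1) (t - t) i j • e t j = e t i := by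
      simp [transition, Matrix.one_apply]
    rw [hx, Nat.add_sub_cancel, Finset.sum_range_succ, hnew, ← hpast, ← hinit, ← add_assoc]
    simp only [ih, smul_add, Finset.sum_add_distrib]

theorem sum_eq_of_perturbed {x e : ℕ → V → E} (hcol : ∀ t j, ∑ i, W t i j = 1)
    (hx : ∀ t i, x (t + 1) i = ∑ j, W t i j • x t j + e t i) (t : ℕ) :
    ∑ i, x t i = ∑ j, x 0 j + ∑ s ∈ Finset.range t, ∑ j, e s j := by
  induction t with
  | zero => simp
  | succ t ih =>
    simp only [hx, Finset.sum_add_distrib]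
    rw [Finset.sum_comm]
    simp only [← Finset.sum_smul, hcol, one_smul]
    rw [ih, Finset.sum_range_succ, add_assoc]

theorem IsMixing.norm_sub_mean_le (h : IsMixing κ B edge W) (hκ₀ : 0 < κ) (hκ₁ : κ < 1)
    {x e : ℕ → V → E} (hx : ∀ t i, x (t + 1) i = ∑ j, W t i j • x t j + e t i) (t : ℕ) (i : V) :
    ‖x t i - (1 / (Fintype.card V : ℝ)) • ∑ j, x t j‖ ≤
      Gam κ (Fintype.card V) * (theta κ (Fintype.card V) B ^ t * ∑ j, ‖x 0 j‖ +
        ∑ s ∈ Finset.range t, theta κ (Fintype.card V) B ^ (t - 1 - s) * ∑ j, ‖e s j‖) := by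
  classical
  set Γ := Gam κ (Fintype.card V)
  set θ := theta κ (Fintype.card V) B
  let M : ℕ → ℕ → V → ℝ := fun s k j => transition W s k i j - 1 / (Fintype.card V : ℝ)
  have hdiff : x t i - (1 / (Fintype.card V : ℝ)) • ∑ j, x t j =
      ∑ j, M 0 t j • x 0 j + ∑ s ∈ Finset.range t, ∑ j, M (s + 1) (t - 1 - s) j • e s j := by
    rw [sum_eq_of_perturbed h.col_sum hx, eq_sum_transition hx t i]
    simp only [M, sub_smul, Finset.sum_sub_distrib, smul_add, Finset.smul_sum]
    abel
  have hterm : ∀ (s k : ℕ) (y : V → E), ‖∑ j, M s k j • y j‖ ≤ Γ * (θ ^ k * ∑ j, ‖y j‖) := by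
    intro s k y
    rw [← mul_assoc, Finset.mul_sum]
    refine norm_sum_le_of_le _ fun j _ => ?_
    rw [norm_smul]
    exact mul_le_mul_of_nonneg_right (h.abs_transition_sub_le hκ₀ hκ₁ s k i j) (norm_nonneg _)
  rw [hdiff, mul_add, Finset.mul_sum (Finset.range t)]
  exact norm_add_le_of_le (hterm _ _ _) (norm_sum_le_of_le _ fun s _ => hterm _ _ _)

end Transition

section Sums

theorem sum_Icc_one_eq_sum_range (f : ℕ → ℝ) (T : ℕ) :
    ∑ t ∈ Finset.Icc 1 T, f t = ∑ t ∈ Finset.range T, f (t + 1) := by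
  rw [← Finset.Ico_add_one_right_eq_Icc, Finset.sum_Ico_eq_sum_range]
  simp [add_comm]

theorem sum_pow_le {θ : ℝ} (hθ₀ : 0 ≤ θ) (hθ₁ : θ < 1) (s : Finset ℕ) :
    ∑ t ∈ s, θ ^ t ≤ 1 / (1 - θ) := by
  rw [one_div, ← tsum_geometric_of_lt_one hθ₀ hθ₁]
  exact (summable_geometric_of_lt_one hθ₀ hθ₁).sum_le_tsum s fun t _ => by positivity

theorem sum_conv_pow_le {θ : ℝ} (hθ₀ : 0 ≤ θ) (hθ₁ : θ < 1) {a : ℕ → ℝ} (ha : ∀ s, 0 ≤ a s)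
    (T : ℕ) : ∑ t ∈ Finset.Icc 1 T, ∑ s ∈ Finset.range t, θ ^ (t - 1 - s) * a s ≤
      1 / (1 - θ) * ∑ s ∈ Finset.range T, a s := by
  have hswap : ∑ t ∈ Finset.range T, ∑ s ∈ Finset.range (t + 1), θ ^ (t - s) * a s =
      ∑ s ∈ Finset.range T, ∑ t ∈ Finset.Ico s T, θ ^ (t - s) * a s :=
    Finset.sum_comm' fun x y => by simp only [Finset.mem_range, Finset.mem_Ico]; omega
  simp only [sum_Icc_one_eq_sum_range, Nat.add_sub_cancel]
  rw [hswap, Finset.mul_sum]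
  refine Finset.sum_le_sum fun s _ => ?_
  rw [← Finset.sum_mul, Finset.sum_Ico_eq_sum_range]
  simp only [Nat.add_sub_cancel_left]
  exact mul_le_mul_of_nonneg_right (sum_pow_le hθ₀ hθ₁ _) (ha s)

theorem sum_inv_succ_le (T : ℕ) : ∑ t ∈ Finset.range T, 1 / ((t : ℝ) + 1) ≤ 1 + Real.log T := by
  simpa [harmonic] using harmonic_le_one_add_log T

end Sums

section Past

variable {Ω : Type*} {d : ℕ} {E F V V' : Type*} [NormedAddCommGroup E] [NormedSpace ℝ E]
  [NormedAddCommGroup F] [NormedSpace ℝ F] [MeasurableSpace E] [MeasurableSpace F]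
  {R : Run Ω E V d} {R' : Run Ω F V' d}

theorem past_mono : Monotone (past R R') := fun s t hst => by
  have hIio : Set.Iio s ⊆ Set.Iio t := Set.Iio_subset_Iio hst
  exact sup_le_sup (sup_le_sup le_rfl (biSup_mono fun _ hi => hIio hi))
    (biSup_mono fun _ hi => hIio hi)

theorem past_le [mΩ : MeasurableSpace Ω] (hx : ∀ i, Measurable (R.x 0 i))
    (hx' : ∀ i, Measurable (R'.x 0 i)) (hξ : ∀ t i, Measurable (R.ξ t i))
    (hξ' : ∀ t i, Measurable (R'.ξ t i)) (t : ℕ) : past R R' t ≤ mΩ :=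
  sup_le (sup_le (sup_le (iSup_le fun i => (hx i).comap_le) (iSup_le fun i => (hx' i).comap_le))
    (iSup₂_le fun s _ => iSup_le fun i => (hξ s i).comap_le))
    (iSup₂_le fun s _ => iSup_le fun i => (hξ' s i).comap_le)

theorem measurable_past_init (i : V) : Measurable[past R R' 0] (R.x 0 i) :=
  Measurable.of_comap_le <|
    (le_iSup (fun i => MeasurableSpace.comap (R.x 0 i) inferInstance) i).trans
      (le_sup_left.trans (le_sup_left.trans le_sup_left))

theorem measurable_past_init' (i : V') : Measurable[past R R' 0] (R'.x 0 i) :=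
  Measurable.of_comap_le <|
    (le_iSup (fun i => MeasurableSpace.comap (R'.x 0 i) inferInstance) i).trans
      (le_sup_right.trans (le_sup_left.trans le_sup_left))

end Past

section Trajectory

variable {Ω : Type*} {d : ℕ} {E F V V' : Type*} [NormedAddCommGroup E] [NormedSpace ℝ E]
  [Fintype V]

theorem measurable_sum_smul [MeasurableSpace E] [BorelSpace E] [FiniteDimensional ℝ E]
    {_ : MeasurableSpace Ω} {x : V → Ω → E} (hx : ∀ i, Measurable (x i)) (w : V → ℝ) :
    Measurable fun ω => ∑ j, w j • x j ω :=
  have := FiniteDimensional.proper ℝ E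
  Finset.measurable_fun_sum _ fun j _ => (hx j).const_smul (w j)

/-- The average of the estimates of all agents, around which the estimates of a network are shown
to concentrate. -/
noncomputable def Run.mean (R : Run Ω E V d) (t : ℕ) (ω : Ω) : E :=
  (1 / (Fintype.card V : ℝ)) • ∑ j, R.x t j ω

theorem Run.measurable_mean [MeasurableSpace Ω] [MeasurableSpace E] [BorelSpace E]
    [FiniteDimensional ℝ E] (R : Run Ω E V d) {t : ℕ} (hx : ∀ i, Measurable (R.x t i)) :
    Measurable (R.mean t) :=
  have := FiniteDimensional.proper ℝ E
  (Finset.measurable_fun_sum Finset.univ fun i _ => hx i).const_smul (1 / Fintype.card V : ℝ)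

variable [mΩ : MeasurableSpace Ω] [NormedAddCommGroup F] [NormedSpace ℝ F] [Fintype V']
  {N : Network E F V V' d} {X' : Set F} {κ : ℝ} {B : ℕ} {P : Measure Ω} {ξ : Ω → Fin d → ℝ}
  {R : Run Ω E V d} {R' : Run Ω F V' d}

theorem Network.IsValid.v_mem (hN : N.IsValid X' κ B P ξ) (hκ : 0 ≤ κ)
    (hx : ∀ t i ω, R.x t i ω ∈ N.X) (t : ℕ) (i : V) (ω : Ω) : N.v R t i ω ∈ N.X :=
  hN.convex.sum_mem (fun j _ => hN.mixing.nonneg hκ t i j) (hN.mixing.row_sum t i)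
    fun j _ => hx t j ω

theorem Network.IsValid.u_mem (hN : N.IsValid X' κ B P ξ) (hX' : Convex ℝ X')
    (hx : ∀ t i ω, R'.x t i ω ∈ X') (t : ℕ) (i : V) (ω : Ω) : N.u R' t i ω ∈ X' :=
  hX'.sum_mem (fun j _ => hN.crossMixing.nonneg t i j) (hN.crossMixing.row_sum t i)
    fun j _ => hx t j ω

namespace Network.Follows

variable [MeasurableSpace E] {ℱ : ℕ → MeasurableSpace Ω} {α : ℕ → ℝ}

theorem x_mem (h : N.Follows ℱ R R' α) (t : ℕ) (i : V) (ω : Ω) : R.x t i ω ∈ N.X := by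
  cases t with
  | zero => exact h.init_mem i ω
  | succ t => exact (h.update t i ω).1

theorem measurable_x [BorelSpace E] [FiniteDimensional ℝ E] (h : N.Follows ℱ R R' α)
    (hN : N.IsValid X' κ B P ξ) (hκ : 0 ≤ κ) (hℱ : Monotone ℱ)
    (hinit : ∀ i, Measurable[ℱ 0] (R.x 0 i)) (t : ℕ) (i : V) : Measurable[ℱ t] (R.x t i) := by
  induction t generalizing i with
  | zero => exact hinit i
  | succ t ih =>
    have hv : Measurable[ℱ (t + 1)] (N.v R t i) :=
      (measurable_sum_smul ih (N.W t i)).mono (hℱ (Nat.le_succ t)) le_rfl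
    have hy : Measurable[ℱ (t + 1)] fun ω => -(α t • R.ghat t i ω) :=
      ((h.measurable_ghat t i).const_smul (α t)).neg
    exact measurable_prox hN.differentiable_reg hN.strongConvex_reg hv (hN.v_mem hκ h.x_mem t i) hy
      (h.update t i)

theorem norm_x_sub_v_le (h : N.Follows ℱ R R' α) (hN : N.IsValid X' κ B P ξ) (hκ : 0 ≤ κ)
    (hα : ∀ t, 0 ≤ α t) (t : ℕ) (i : V) (ω : Ω) :
    ‖R.x (t + 1) i ω - N.v R t i ω‖ ≤ α t * ‖R.ghat t i ω‖ := by
  have := (h.update t i ω).norm_sub_le hN.differentiable_reg hN.strongConvex_reg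
    (hN.v_mem hκ h.x_mem t i ω)
  rwa [norm_neg, norm_smul, Real.norm_of_nonneg (hα t)] at this

theorem norm_x_sub_mean_le (h : N.Follows ℱ R R' α) (hN : N.IsValid X' κ B P ξ) (hκ₀ : 0 < κ)
    (hκ₁ : κ < 1) (hα : ∀ t, 0 ≤ α t) (t : ℕ) (i : V) (ω : Ω) :
    ‖R.x t i ω - R.mean t ω‖ ≤
      Gam κ (Fintype.card V) * (theta κ (Fintype.card V) B ^ t * ∑ j, ‖R.x 0 j ω‖ +
        ∑ s ∈ Finset.range t, theta κ (Fintype.card V) B ^ (t - 1 - s) *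
          ∑ j, α s * ‖R.ghat s j ω‖) := by
  have : Nonempty V := ⟨i⟩
  have hθ := theta_pos (B := B) hκ₁ (Fintype.card_ne_zero (α := V))
  have hΓ := Gam_pos hκ₁ (Fintype.card_ne_zero (α := V))
  refine (hN.mixing.norm_sub_mean_le hκ₀ hκ₁ (x := fun t j => R.x t j ω)
    (e := fun t j => R.x (t + 1) j ω - N.v R t j ω)
    (fun t j => (add_sub_cancel (N.v R t j ω) _).symm) t i).trans ?_
  gcongr
  exact h.norm_x_sub_v_le hN hκ₀.le hα _ _ ω

end Network.Follows

end Trajectory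

section MeanLE

variable {Ω : Type*} [MeasurableSpace Ω] {P : Measure Ω} {f g : Ω → ℝ} {a b c L ν : ℝ}

/-- `f` is integrable with expectation at most `c`. Integrability is part of the notion because the
Bochner integral of a function that is not integrable is `0`. -/
def MeanLE (P : Measure Ω) (f : Ω → ℝ) (c : ℝ) : Prop :=
  Integrable f P ∧ ∫ ω, f ω ∂P ≤ c

namespace MeanLE

theorem const [IsProbabilityMeasure P] (c : ℝ) : MeanLE P (fun _ => c) c :=
  ⟨integrable_const c, by simp⟩

theorem add (hf : MeanLE P f a) (hg : MeanLE P g b) : MeanLE P (fun ω => f ω + g ω) (a + b) :=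
  ⟨hf.1.add hg.1, (integral_add hf.1 hg.1).trans_le (add_le_add hf.2 hg.2)⟩

theorem const_mul (hc : 0 ≤ c) (hf : MeanLE P f a) : MeanLE P (fun ω => c * f ω) (c * a) :=
  ⟨hf.1.const_mul c, (integral_const_mul c f).trans_le (mul_le_mul_of_nonneg_left hf.2 hc)⟩

theorem sum {ι : Type*} {s : Finset ι} {f : ι → Ω → ℝ} {a : ι → ℝ}
    (hf : ∀ i ∈ s, MeanLE P (f i) (a i)) : MeanLE P (fun ω => ∑ i ∈ s, f i ω) (∑ i ∈ s, a i) :=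
  ⟨integrable_finsetSum s fun i hi => (hf i hi).1,
    (integral_finsetSum s fun i hi => (hf i hi).1).trans_le
      (Finset.sum_le_sum fun i hi => (hf i hi).2)⟩

theorem weighted {ι : Type*} [Fintype ι] {w : ι → ℝ} (hw : ∀ i, 0 ≤ w i) (hw₁ : ∑ i, w i = 1)
    {f : ι → Ω → ℝ} (hf : ∀ i, MeanLE P (f i) c) : MeanLE P (fun ω => ∑ i, w i * f i ω) c := by
  have := MeanLE.sum (s := Finset.univ) fun i _ => (hf i).const_mul (hw i)
  rwa [← Finset.sum_mul, hw₁, one_mul] at this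

theorem of_le (hg : MeanLE P g c) (hf : AEStronglyMeasurable f P) (hf₀ : ∀ ω, 0 ≤ f ω)
    (hfg : ∀ᵐ ω ∂P, f ω ≤ g ω) : MeanLE P f c := by
  have hint : Integrable f P := hg.1.mono' hf <| by
    filter_upwards [hfg] with ω hω
    rwa [Real.norm_of_nonneg (hf₀ ω)]
  exact ⟨hint, (integral_mono_ae hint hg.1 hfg).trans hg.2⟩

variable [IsProbabilityMeasure P]

theorem of_sq (hf : AEStronglyMeasurable f P) (hν : 0 ≤ ν)
    (hsq : MeanLE P (fun ω => f ω ^ 2) (ν ^ 2)) : MeanLE P f ν := by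
  have hL2 : MemLp f 2 P := (memLp_two_iff_integrable_sq hf).2 hsq.1
  have hmean : (∫ ω, f ω ∂P) ^ 2 ≤ ν ^ 2 :=
    (sub_nonneg.1 ((variance_nonneg f P).trans_eq (variance_eq_sub hL2))).trans hsq.2
  exact ⟨hL2.integrable one_le_two, abs_le_of_sq_le_sq' hmean hν |>.2⟩

theorem sq_const_add (hf : AEStronglyMeasurable f P) (hL : 0 ≤ L) (hν : 0 ≤ ν)
    (hsq : MeanLE P (fun ω => f ω ^ 2) (ν ^ 2)) :
    MeanLE P (fun ω => (L + f ω) ^ 2) ((L + ν) ^ 2) := by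
  convert ((const (P := P) (L ^ 2)).add ((of_sq hf hν hsq).const_mul
    (mul_nonneg zero_le_two hL))).add hsq using 1
  · ext ω
    ring
  · ring

theorem sq_norm_of_sq_norm_sub {E : Type*} [NormedAddCommGroup E] {X Y : Ω → E}
    (hXm : AEStronglyMeasurable X P) (hYm : AEStronglyMeasurable Y P) (hL : 0 ≤ L) (hν : 0 ≤ ν)
    (hX : ∀ᵐ ω ∂P, ‖X ω‖ ≤ L) (hsq : MeanLE P (fun ω => ‖X ω - Y ω‖ ^ 2) (ν ^ 2)) :
    MeanLE P (fun ω => ‖Y ω‖ ^ 2) ((L + ν) ^ 2) := by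
  refine (sq_const_add (hXm.sub hYm).norm hL hν hsq).of_le (hYm.norm.pow 2)
    (fun ω => sq_nonneg _) ?_
  filter_upwards [hX] with ω hω
  gcongr
  exact (norm_le_norm_add_norm_sub (X ω) (Y ω)).trans (add_le_add hω le_rfl)

end MeanLE

end MeanLE

section Oracle

variable {Ω : Type*} {m : MeasurableSpace Ω} [mΩ : MeasurableSpace Ω] {P : Measure Ω} {E : Type*}
  [NormedAddCommGroup E] [NormedSpace ℝ E]

section Bounded

variable [FiniteDimensional ℝ E] [MeasurableSpace E] [BorelSpace E] {h : Ω → StrongDual ℝ E}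
  {w : Ω → E} {C : ℝ}

theorem integrable_clm_apply_of_bounded (hh : Integrable h P) (hw : Measurable w)
    (hC : ∀ ω, ‖w ω‖ ≤ C) : Integrable (fun ω => h ω (w ω)) P := by
  have := FiniteDimensional.proper ℝ E
  refine (hh.norm.mul_const C).mono' ?_ (Eventually.of_forall fun ω => (h ω).le_opNorm_of_le (hC ω))
  exact (isBoundedBilinearMap_apply (𝕜 := ℝ) (E := E) (F := ℝ)).continuous.comp_aestronglyMeasurable
    (hh.aestronglyMeasurable.prodMk hw.aestronglyMeasurable)

theorem integral_condExp_apply (hm : m ≤ mΩ) [SigmaFinite (P.trim hm)] (hh : Integrable h P)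
    (hw : Measurable[m] w) (hC : ∀ ω, ‖w ω‖ ≤ C) :
    ∫ ω, (P[h | m]) ω (w ω) ∂P = ∫ ω, h ω (w ω) ∂P := by
  have := FiniteDimensional.proper ℝ E
  have hpull := condExp_bilin_of_stronglyMeasurable_right (μ := P) (m := m)
    (ContinuousLinearMap.id ℝ (StrongDual ℝ E)) hw.stronglyMeasurable
    (integrable_clm_apply_of_bounded hh (hw.mono hm le_rfl) hC) hh
  simp only [ContinuousLinearMap.id_apply] at hpull
  rw [← integral_congr_ae hpull, integral_condExp hm]

end Bounded

namespace Network

variable {d : ℕ} {F V V' : Type*} [NormedAddCommGroup F] [NormedSpace ℝ F] [Fintype V]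
  [Fintype V'] {N : Network E F V V' d} {X' : Set F} {κ : ℝ} {B : ℕ} {ξ : Ω → Fin d → ℝ}
  {R : Run Ω E V d} {R' : Run Ω F V' d} {ℱ : ℕ → MeasurableSpace Ω} {L ν : ℝ}

namespace UnbiasedOracle

theorem ae_norm_g_le (hor : N.UnbiasedOracle P ξ ℱ R R' ν) (hN : N.IsValid X' κ B P ξ)
    (hLip : N.LipschitzCosts X' P ξ L) (hL : 0 ≤ L) (t : ℕ) (i : V)
    (hv : ∀ ω, N.v R t i ω ∈ N.X) (hu : ∀ ω, N.u R' t i ω ∈ X') : ∀ᵐ ω ∂P, ‖R.g t i ω‖ ≤ L := by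
  filter_upwards [hor.g_mem t i] with ω hω
  have hvO := hN.subset (hv ω)
  exact norm_le_of_mem_subdiff (hN.isOpen.mem_nhds hvO) hL
    (fun x hx => hLip.lipschitz_own i x hx _ hvO _ (hu ω)) hω

theorem integrable_g (hor : N.UnbiasedOracle P ξ ℱ R R' ν) (t : ℕ) (i : V) :
    Integrable (R.g t i) P :=
  integrable_condExp.congr (hor.unbiased t i)

variable [IsProbabilityMeasure P]

theorem meanLE_sq_noise (hor : N.UnbiasedOracle P ξ ℱ R R' ν) (hℱ : ∀ t, ℱ t ≤ mΩ) (t : ℕ)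
    (i : V) : MeanLE P (fun ω => ‖R.g t i ω - R.ghat t i ω‖ ^ 2) (ν ^ 2) := by
  refine ⟨hor.integrable_sq t i, ?_⟩
  rw [← integral_condExp (hℱ t)]
  exact (integral_mono_ae integrable_condExp (integrable_const _) (hor.variance_le t i)).trans
    (by simp)

theorem meanLE_sq_norm_ghat (hor : N.UnbiasedOracle P ξ ℱ R R' ν) (hℱ : ∀ t, ℱ t ≤ mΩ)
    (hL : 0 ≤ L) (hν : 0 ≤ ν) {t : ℕ} {i : V} (hg : ∀ᵐ ω ∂P, ‖R.g t i ω‖ ≤ L) :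
    MeanLE P (fun ω => ‖R.ghat t i ω‖ ^ 2) ((L + ν) ^ 2) :=
  .sq_norm_of_sq_norm_sub (hor.integrable_g t i).aestronglyMeasurable
    (hor.integrable t i).aestronglyMeasurable hL hν hg (hor.meanLE_sq_noise hℱ t i)

theorem meanLE_norm_ghat (hor : N.UnbiasedOracle P ξ ℱ R R' ν) (hℱ : ∀ t, ℱ t ≤ mΩ)
    (hL : 0 ≤ L) (hν : 0 ≤ ν) {t : ℕ} {i : V} (hg : ∀ᵐ ω ∂P, ‖R.g t i ω‖ ≤ L) :
    MeanLE P (fun ω => ‖R.ghat t i ω‖) (L + ν) :=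
  .of_sq (hor.integrable t i).aestronglyMeasurable.norm (add_nonneg hL hν)
    (hor.meanLE_sq_norm_ghat hℱ hL hν hg)

theorem meanLE_noise_apply [FiniteDimensional ℝ E] [MeasurableSpace E] [BorelSpace E]
    (hor : N.UnbiasedOracle P ξ ℱ R R' ν) (hℱ : ∀ t, ℱ t ≤ mΩ) (t : ℕ) (i : V) {w : Ω → E}
    (hw : Measurable[ℱ t] w) {C : ℝ} (hC : ∀ ω, ‖w ω‖ ≤ C) :
    MeanLE P (fun ω => (R.g t i ω - R.ghat t i ω) (w ω)) 0 := by
  have hw' : Measurable w := hw.mono (hℱ t) le_rfl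
  have hg := integrable_clm_apply_of_bounded (hor.integrable_g t i) hw' hC
  have hghat := integrable_clm_apply_of_bounded (hor.integrable t i) hw' hC
  have hmean : ∫ ω, R.g t i ω (w ω) ∂P = ∫ ω, R.ghat t i ω (w ω) ∂P := by
    rw [← integral_condExp_apply (hℱ t) (hor.integrable t i) hw hC]
    refine integral_congr_ae ?_
    filter_upwards [hor.unbiased t i] with ω hω
    rw [hω]
  exact ⟨hg.sub hghat, (integral_sub hg hghat).trans_le (sub_nonpos.2 hmean.le)⟩

end UnbiasedOracle

end Network

end Oracle

section Disagreement

/-- Bound on the expected disagreement at time `t` in a network of `n` agents with step sizes `α`,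
when `Λ` bounds the expected norms of the initial estimates and `G` those of the sampled
subgradients. -/
noncomputable def disagreement (κ : ℝ) (n B : ℕ) (α : ℕ → ℝ) (Λ G : ℝ) (t : ℕ) : ℝ :=
  n * Gam κ n * (theta κ n B ^ t * Λ +
    ∑ s ∈ Finset.range t, theta κ n B ^ (t - 1 - s) * (α s * G))

theorem sum_disagreement_le {κ : ℝ} (hκ₀ : 0 < κ) (hκ₁ : κ < 1) {n B : ℕ} (hn : n ≠ 0)
    (hB : 1 ≤ B) {α : ℕ → ℝ} (hα : ∀ t, 0 ≤ α t) {Λ G : ℝ} (hΛ : 0 ≤ Λ) (hG : 0 ≤ G) (T : ℕ) :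
    ∑ t ∈ Finset.Icc 1 T, disagreement κ n B α Λ G t ≤
      constCoeff (Λ + G * ∑ s ∈ Finset.range T, α s) κ n B := by
  have hθ₀ := (theta_pos (B := B) hκ₁ hn).le
  have hθ₁ := theta_lt_one hκ₀ hκ₁ hn hB
  have hΓ := Gam_pos hκ₁ hn
  simp only [disagreement, constCoeff]
  calc ∑ t ∈ Finset.Icc 1 T, n * Gam κ n * (theta κ n B ^ t * Λ +
          ∑ s ∈ Finset.range t, theta κ n B ^ (t - 1 - s) * (α s * G))
      = n * Gam κ n * ((∑ t ∈ Finset.Icc 1 T, theta κ n B ^ t) * Λ +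
          ∑ t ∈ Finset.Icc 1 T, ∑ s ∈ Finset.range t, theta κ n B ^ (t - 1 - s) * (α s * G)) := by
        rw [← Finset.mul_sum, Finset.sum_add_distrib, ← Finset.sum_mul]
    _ ≤ n * Gam κ n * (1 / (1 - theta κ n B) * Λ +
          1 / (1 - theta κ n B) * ∑ s ∈ Finset.range T, α s * G) := by
        gcongr
        · exact sum_pow_le hθ₀ hθ₁ _
        · exact sum_conv_pow_le hθ₀ hθ₁ (fun s => mul_nonneg (hα s) hG) T
    _ = n * Gam κ n * (Λ + G * ∑ s ∈ Finset.range T, α s) / (1 - theta κ n B) := by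
        rw [← Finset.sum_mul]
        ring

variable {Ω : Type*} [MeasurableSpace Ω] {P : Measure Ω} {d : ℕ} {E : Type*}
  [NormedAddCommGroup E]

theorem meanLE_norm_le_iSup [IsFiniteMeasure P] {V : Type*} [Finite V] [MeasurableSpace E]
    [OpensMeasurableSpace E] {X : Set E} (hX : Bornology.IsBounded X) {x : V → Ω → E}
    (hx : ∀ i, Measurable (x i)) (hxX : ∀ i ω, x i ω ∈ X) (i : V) :
    MeanLE P (fun ω => ‖x i ω‖) (∫ ω, ⨆ j, ‖x j ω‖ ∂P) := by
  have : Nonempty V := ⟨i⟩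
  obtain ⟨C, hC⟩ := hX.exists_norm_le
  have hle : ∀ ω, ‖x i ω‖ ≤ ⨆ j, ‖x j ω‖ := fun ω =>
    le_ciSup (f := fun j => ‖x j ω‖) (Set.finite_range _).bddAbove i
  have hint : Integrable (fun ω => ⨆ j, ‖x j ω‖) P := by
    refine (integrable_const C).mono' (Measurable.iSup fun j => (hx j).norm).aestronglyMeasurable
      (Eventually.of_forall fun ω => ?_)
    rw [Real.norm_of_nonneg ((norm_nonneg _).trans (hle ω))]
    exact ciSup_le fun j => hC _ (hxX j ω)
  exact .of_le ⟨hint, le_rfl⟩ (hx i).norm.aestronglyMeasurable (fun _ => norm_nonneg _)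
    (Eventually.of_forall hle)

variable [NormedSpace ℝ E]

theorem Lam_nonneg {V : Type*} (P : Measure Ω) (R : Run Ω E V d) : 0 ≤ Lam P R :=
  integral_nonneg fun _ => Real.iSup_nonneg fun _ => norm_nonneg _

variable [IsProbabilityMeasure P] [FiniteDimensional ℝ E] [MeasurableSpace E] [BorelSpace E]
  {F V V' : Type*} [NormedAddCommGroup F] [NormedSpace ℝ F] [Fintype V] [Fintype V']
  {N : Network E F V V' d} {X' : Set F} {κ : ℝ} {B : ℕ} {ξ : Ω → Fin d → ℝ} {R : Run Ω E V d}
  {R' : Run Ω F V' d} {ℱ : ℕ → MeasurableSpace Ω} {α : ℕ → ℝ}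

theorem Network.Follows.meanLE_norm_x_sub_mean {G : ℝ} (h : N.Follows ℱ R R' α)
    (hN : N.IsValid X' κ B P ξ) (hκ₀ : 0 < κ) (hκ₁ : κ < 1) (hα : ∀ t, 0 ≤ α t)
    (hx : ∀ t i, Measurable (R.x t i)) (hG : ∀ t i, MeanLE P (fun ω => ‖R.ghat t i ω‖) G)
    (t : ℕ) (i : V) :
    MeanLE P (fun ω => ‖R.x t i ω - R.mean t ω‖)
      (disagreement κ (Fintype.card V) B α (Lam P R) G t) := by
  have : Nonempty V := ⟨i⟩
  have hθ := (theta_pos (B := B) hκ₁ (Fintype.card_ne_zero (α := V))).le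
  have hΓ := (Gam_pos hκ₁ (Fintype.card_ne_zero (α := V))).le
  have hinit : MeanLE P (fun ω => ∑ j, ‖R.x 0 j ω‖) (∑ _j : V, Lam P R) :=
    .sum fun j _ => meanLE_norm_le_iSup hN.isCompact.isBounded (hx 0) (h.x_mem 0) j
  have hpert : ∀ s, MeanLE P (fun ω => ∑ j, α s * ‖R.ghat s j ω‖) (∑ _j : V, α s * G) :=
    fun s => .sum fun j _ => (hG s j).const_mul (hα s)
  have hcoeff : disagreement κ (Fintype.card V) B α (Lam P R) G t =
      Gam κ (Fintype.card V) * (theta κ (Fintype.card V) B ^ t * ∑ _j : V, Lam P R +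
        ∑ s ∈ Finset.range t, theta κ (Fintype.card V) B ^ (t - 1 - s) * ∑ _j : V, α s * G) := by
    simp only [disagreement, Finset.sum_const, Finset.card_univ, nsmul_eq_mul,
      mul_left_comm _ (Fintype.card V : ℝ), ← Finset.mul_sum]
    ring
  rw [hcoeff]
  exact .of_le (((hinit.const_mul (pow_nonneg hθ t)).add (.sum fun s _ =>
      (hpert s).const_mul (pow_nonneg hθ (t - 1 - s)))).const_mul hΓ)
    ((hx t i).sub (R.measurable_mean (hx t))).norm.aestronglyMeasurable (fun _ => norm_nonneg _)
    (Eventually.of_forall (h.norm_x_sub_mean_le hN hκ₀ hκ₁ hα t i))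

end Disagreement

section Descent

theorem StronglyConvexWrt.sub_le_of_isProx {E : Type*} [NormedAddCommGroup E] [NormedSpace ℝ E]
    {O X : Set E} {ψ f : E → ℝ} {η α : ℝ} {p q x : E} {g ghat : StrongDual ℝ E}
    (hf : StronglyConvexWrt O X ψ η f) (hdiff : DifferentiableOn ℝ ψ X)
    (hψ : StrongConvexOn X 1 ψ) (hα : 0 < α) (hp : p ∈ X) (hx : x ∈ X) (hg : g ∈ subdiff O f p)
    (hq : IsProx X ψ p (-(α • ghat)) q) :
    f p - f x ≤ (1 / α - η) * bregman X ψ x p - 1 / α * bregman X ψ x q +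
      (α / 2 * ‖ghat‖ ^ 2 + (g - ghat) (p - x)) := by
  have hstrong := hf x hx p hp g hg
  have hdescent := mul_le_mul_of_nonneg_left (hq.descent hdiff hψ hp hx) (one_div_pos.2 hα).le
  have hleft : 1 / α * (α * ghat (p - x)) = ghat (p - x) := by field_simp
  have hright : 1 / α * (bregman X ψ x p - bregman X ψ x q + α ^ 2 * ‖ghat‖ ^ 2 / 2) =
      1 / α * bregman X ψ x p - 1 / α * bregman X ψ x q + α / 2 * ‖ghat‖ ^ 2 := by
    field_simp
  rw [hleft, hright] at hdescent
  simp only [sub_apply, map_sub] at hstrong hdescent ⊢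
  linarith

theorem stepSize_pos {η : ℝ} (hη : 0 < η) (t : ℕ) : 0 < stepSize η t := by
  unfold stepSize
  positivity

theorem one_div_stepSize (η : ℝ) (t : ℕ) : 1 / stepSize η t = η * (t + 1) :=
  one_div_one_div _

theorem IsMixing.sum_map_sum_smul_le {V E : Type*} [Fintype V] [AddCommGroup E] [Module ℝ E]
    {κ : ℝ} {B : ℕ} {edge : ℕ → V → V → Prop} {W : ℕ → Matrix V V ℝ} (h : IsMixing κ B edge W)
    (hκ : 0 ≤ κ) {X : Set E} {φ : E → ℝ} (hφ : ConvexOn ℝ X φ) {y : V → E} (hy : ∀ j, y j ∈ X)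
    (t : ℕ) : ∑ i, φ (∑ j, W t i j • y j) ≤ ∑ j, φ (y j) := by
  calc ∑ i, φ (∑ j, W t i j • y j) ≤ ∑ i, ∑ j, W t i j * φ (y j) :=
        Finset.sum_le_sum fun i _ =>
          hφ.map_sum_le (fun j _ => h.nonneg hκ t i j) (h.row_sum t i) fun j _ => hy j
    _ = ∑ j, φ (y j) := by
        rw [Finset.sum_comm]
        simp only [← Finset.sum_mul, h.col_sum, one_mul]

variable {Ω : Type*} [MeasurableSpace Ω] {d : ℕ} {E F V V' : Type*}
  [NormedAddCommGroup E] [NormedSpace ℝ E] [MeasurableSpace E]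
  [NormedAddCommGroup F] [NormedSpace ℝ F] [Fintype V] [Fintype V']
  {N : Network E F V V' d} {X' : Set F} {κ : ℝ} {B : ℕ} {P : Measure Ω} {ξ : Ω → Fin d → ℝ}
  {R : Run Ω E V d} {R' : Run Ω F V' d} {ℱ : ℕ → MeasurableSpace Ω} {η : ℝ}

namespace Network.Follows

theorem sum_cost_sub_le (h : N.Follows ℱ R R' (stepSize η)) (hN : N.IsValid X' κ B P ξ)
    (hκ : 0 ≤ κ) (hη : 0 < η)
    (hsc : ∀ i, ∀ y ∈ X', StronglyConvexWrt N.O N.X N.ψ η (fun x => N.cost P ξ i x y)) {t : ℕ}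
    {ω : Ω} (hu : ∀ i, N.u R' t i ω ∈ X') {x : E} (hx : x ∈ N.X)
    (hconv : ConvexOn ℝ N.X fun y => bregman N.X N.ψ x y)
    (hg : ∀ i, R.g t i ω ∈ subdiff N.O (fun x => N.cost P ξ i x (N.u R' t i ω)) (N.v R t i ω)) :
    ∑ j, (N.cost P ξ j (N.v R t j ω) (N.u R' t j ω) - N.cost P ξ j x (N.u R' t j ω)) ≤
      η * t * ∑ j, bregman N.X N.ψ x (R.x t j ω) -
        η * (t + 1) * ∑ j, bregman N.X N.ψ x (R.x (t + 1) j ω) +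
      ∑ j, (stepSize η t / 2 * ‖R.ghat t j ω‖ ^ 2 +
        (R.g t j ω - R.ghat t j ω) (N.v R t j ω - x)) := by
  have hagent : ∀ j, N.cost P ξ j (N.v R t j ω) (N.u R' t j ω) - N.cost P ξ j x (N.u R' t j ω) ≤
      η * t * bregman N.X N.ψ x (N.v R t j ω) -
        η * (t + 1) * bregman N.X N.ψ x (R.x (t + 1) j ω) +
      (stepSize η t / 2 * ‖R.ghat t j ω‖ ^ 2 +
        (R.g t j ω - R.ghat t j ω) (N.v R t j ω - x)) := fun j => by
    convert (hsc j _ (hu j)).sub_le_of_isProx hN.differentiable_reg hN.strongConvex_reg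
      (stepSize_pos hη t) (hN.v_mem hκ h.x_mem t j ω) hx (hg j) (h.update t j ω) using 4 <;>
    rw [one_div_stepSize]
    ring
  have hmix := hN.mixing.sum_map_sum_smul_le hκ hconv (fun j => h.x_mem t j ω) t
  refine (Finset.sum_le_sum fun j _ => hagent j).trans ?_
  rw [Finset.sum_add_distrib, Finset.sum_sub_distrib, ← Finset.mul_sum, ← Finset.mul_sum]
  gcongr η * t * ?_ - _ + _
  exact hmix

theorem sum_sum_cost_sub_le (h : N.Follows ℱ R R' (stepSize η)) (hN : N.IsValid X' κ B P ξ)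
    (hκ : 0 ≤ κ) (hη : 0 < η)
    (hsc : ∀ i, ∀ y ∈ X', StronglyConvexWrt N.O N.X N.ψ η (fun x => N.cost P ξ i x y)) {ω : Ω}
    (hu : ∀ t i, N.u R' t i ω ∈ X') {x : E} (hx : x ∈ N.X)
    (hconv : ConvexOn ℝ N.X fun y => bregman N.X N.ψ x y)
    (hg : ∀ t i, R.g t i ω ∈ subdiff N.O (fun x => N.cost P ξ i x (N.u R' t i ω)) (N.v R t i ω))
    (T : ℕ) :
    ∑ t ∈ Finset.range T, ∑ j, (N.cost P ξ j (N.v R t j ω) (N.u R' t j ω) -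
        N.cost P ξ j x (N.u R' t j ω)) ≤
      ∑ t ∈ Finset.range T, ∑ j, (stepSize η t / 2 * ‖R.ghat t j ω‖ ^ 2 +
        (R.g t j ω - R.ghat t j ω) (N.v R t j ω - x)) := by
  let potential : ℕ → ℝ := fun t => η * t * ∑ j, bregman N.X N.ψ x (R.x t j ω)
  have hstart : potential 0 = 0 := by simp [potential]
  have hend : 0 ≤ potential T := mul_nonneg (by positivity) <| Finset.sum_nonneg fun j _ =>
    bregman_nonneg hN.differentiable_reg hN.strongConvex_reg hx (h.x_mem T j ω)
  calc _ ≤ ∑ t ∈ Finset.range T, (potential t - potential (t + 1) +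
          ∑ j, (stepSize η t / 2 * ‖R.ghat t j ω‖ ^ 2 +
            (R.g t j ω - R.ghat t j ω) (N.v R t j ω - x))) :=
        Finset.sum_le_sum fun t _ => by
          simpa only [potential, Nat.cast_add_one] using
            h.sum_cost_sub_le hN hκ hη hsc (hu t) hx hconv (hg t)
    _ ≤ _ := by
        rw [Finset.sum_add_distrib, Finset.sum_range_sub', hstart]
        linarith

end Network.Follows

end Descent

section Deviation

variable {ι E : Type*} [Fintype ι] [NormedAddCommGroup E] [NormedSpace ℝ E]

theorem norm_sum_smul_sub_le {w : ι → ℝ} (hw : ∀ i, 0 ≤ w i) (hw₁ : ∑ i, w i = 1) (x : ι → E)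
    (c : E) : ‖∑ i, w i • x i - c‖ ≤ ∑ i, w i * ‖x i - c‖ := by
  have hcenter : ∑ i, w i • x i - c = ∑ i, w i • (x i - c) := by
    simp only [smul_sub, Finset.sum_sub_distrib, ← Finset.sum_smul, hw₁, one_smul]
  rw [hcenter]
  refine (norm_sum_le _ _).trans_eq (Finset.sum_congr rfl fun i _ => ?_)
  rw [norm_smul, Real.norm_of_nonneg (hw i)]

variable {Ω : Type*} [MeasurableSpace Ω] {P : Measure Ω} {a b : ℝ}

theorem MeanLE.norm_sum_smul_sub {w : ι → ℝ} (hw : ∀ i, 0 ≤ w i) (hw₁ : ∑ i, w i = 1)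
    {x : ι → Ω → E} {c : Ω → E} (hx : ∀ i, AEStronglyMeasurable (x i) P)
    (hc : AEStronglyMeasurable c P) (h : ∀ i, MeanLE P (fun ω => ‖x i ω - c ω‖) a) :
    MeanLE P (fun ω => ‖∑ i, w i • x i ω - c ω‖) a :=
  (MeanLE.weighted hw hw₁ h).of_le
    ((Finset.aestronglyMeasurable_fun_sum _ fun i _ => (hx i).const_smul (w i)).sub hc).norm
    (fun _ => norm_nonneg _) (Eventually.of_forall fun _ => norm_sum_smul_sub_le hw hw₁ _ _)

theorem MeanLE.norm_sub_of_center {E : Type*} [NormedAddCommGroup E] {x y c : Ω → E}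
    (hx : AEStronglyMeasurable x P) (hy : AEStronglyMeasurable y P)
    (hxc : MeanLE P (fun ω => ‖x ω - c ω‖) a) (hyc : MeanLE P (fun ω => ‖y ω - c ω‖) b) :
    MeanLE P (fun ω => ‖x ω - y ω‖) (a + b) :=
  (hxc.add hyc).of_le (hx.sub hy).norm (fun _ => norm_nonneg _) <| Eventually.of_forall fun ω => by
    rw [norm_sub_rev (y ω)]
    exact norm_sub_le_norm_sub_add_norm_sub _ _ _

end Deviation

section LipschitzCosts

variable {Ω : Type*} [MeasurableSpace Ω] {d : ℕ} {E F V V' : Type*} [NormedAddCommGroup E]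
  [NormedAddCommGroup F] {N : Network E F V V' d} {X' : Set F} {P : Measure Ω} {ξ : Ω → Fin d → ℝ}
  {L : ℝ}

theorem Network.LipschitzCosts.cost_sub_cost_le (hLip : N.LipschitzCosts X' P ξ L) (i : V)
    {x x₁ x₂ : E} (hx : x ∈ N.X) (hx₁ : x₁ ∈ N.X) (hx₂ : x₂ ∈ N.X) {y₁ y₂ : F} (hy₁ : y₁ ∈ X')
    (hy₂ : y₂ ∈ X') : N.cost P ξ i x₁ y₁ - N.cost P ξ i x y₁ ≤
      (N.cost P ξ i x₂ y₂ - N.cost P ξ i x y₂) + L * (‖x₁ - x₂‖ + 2 * ‖y₁ - y₂‖) := by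
  have hmoved := le_of_abs_le (hLip.lipschitz i x₁ hx₁ x₂ hx₂ y₁ hy₁ y₂ hy₂)
  have hfixed := neg_le_of_abs_le (hLip.lipschitz i x hx x hx y₁ hy₁ y₂ hy₂)
  rw [sub_self, norm_zero, zero_add] at hfixed
  linarith

end LipschitzCosts

section Regret

variable {Ω : Type*} [mΩ : MeasurableSpace Ω] {d : ℕ} {E F V V' : Type*}
  [NormedAddCommGroup E] [NormedSpace ℝ E] [NormedAddCommGroup F] [NormedSpace ℝ F]
  [Fintype V] [Fintype V'] {N : Network E F V V' d} {X' : Set F} {κ : ℝ} {B : ℕ}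
  {P : Measure Ω} {ξ : Ω → Fin d → ℝ} {R : Run Ω E V d} {R' : Run Ω F V' d}
  {ℱ : ℕ → MeasurableSpace Ω} {η L : ℝ}

namespace Network

/-- The price that agent `i` pays for the disagreement in the two networks: the Lipschitz bound for
replacing its own points `x_i`, `u_i` in the costs of the agents `j` by the points `v_j`, `u_j` at
which these agents draw their subgradients. -/
noncomputable def mismatch (N : Network E F V V' d) (R : Run Ω E V d) (R' : Run Ω F V' d)
    (L : ℝ) (t : ℕ) (i : V) (ω : Ω) : ℝ :=
  ∑ j, 1 / (Fintype.card V : ℝ) *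
    (L * (‖R.x t i ω - N.v R t j ω‖ + 2 * ‖N.u R' t i ω - N.u R' t j ω‖))

theorem LipschitzCosts.avgCost_sub_le (hLip : N.LipschitzCosts X' P ξ L) {t : ℕ} {i : V} {ω : Ω}
    (hxi : R.x t i ω ∈ N.X) (hv : ∀ j, N.v R t j ω ∈ N.X) (hu : ∀ j, N.u R' t j ω ∈ X') {x : E}
    (hx : x ∈ N.X) :
    N.avgCost P ξ (R.x t i ω) (N.u R' t i ω) - N.avgCost P ξ x (N.u R' t i ω) ≤
      1 / (Fintype.card V : ℝ) * ∑ j, (N.cost P ξ j (N.v R t j ω) (N.u R' t j ω) -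
        N.cost P ξ j x (N.u R' t j ω)) + N.mismatch R R' L t i ω := by
  simp only [avgCost, mismatch]
  rw [← mul_sub, ← Finset.sum_sub_distrib, ← Finset.mul_sum, ← mul_add, ← Finset.sum_add_distrib]
  gcongr with j
  exact hLip.cost_sub_cost_le j hx hxi (hv j) (hu i) (hu j)

theorem IsValid.meanLE_mismatch [MeasurableSpace E] [BorelSpace E] [FiniteDimensional ℝ E]
    [MeasurableSpace F] [BorelSpace F] [FiniteDimensional ℝ F] (hN : N.IsValid X' κ B P ξ)
    (hκ : 0 ≤ κ) (hL : 0 ≤ L) {t : ℕ} (hx : ∀ i, Measurable (R.x t i))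
    (hx' : ∀ i, Measurable (R'.x t i)) {δ δ' : ℝ}
    (hδ : ∀ i, MeanLE P (fun ω => ‖R.x t i ω - R.mean t ω‖) δ)
    (hδ' : ∀ i, MeanLE P (fun ω => ‖R'.x t i ω - R'.mean t ω‖) δ') (i : V) :
    MeanLE P (N.mismatch R R' L t i) (L * ((δ + δ) + 2 * (δ' + δ'))) := by
  have : Nonempty V := ⟨i⟩
  have := FiniteDimensional.proper ℝ E
  have := FiniteDimensional.proper ℝ F
  have hv : ∀ j, AEStronglyMeasurable (N.v R t j) P := fun j =>
    (measurable_sum_smul hx (N.W t j)).aestronglyMeasurable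
  have hu : ∀ j, AEStronglyMeasurable (N.u R' t j) P := fun j =>
    (measurable_sum_smul hx' (N.C t j)).aestronglyMeasurable
  have hvδ : ∀ j, MeanLE P (fun ω => ‖N.v R t j ω - R.mean t ω‖) δ := fun j =>
    .norm_sum_smul_sub (hN.mixing.nonneg hκ t j) (hN.mixing.row_sum t j)
      (fun k => (hx k).aestronglyMeasurable) (R.measurable_mean hx).aestronglyMeasurable hδ
  have huδ : ∀ j, MeanLE P (fun ω => ‖N.u R' t j ω - R'.mean t ω‖) δ' := fun j =>
    .norm_sum_smul_sub (hN.crossMixing.nonneg t j) (hN.crossMixing.row_sum t j)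
      (fun k => (hx' k).aestronglyMeasurable) (R'.measurable_mean hx').aestronglyMeasurable hδ'
  exact .weighted (fun _ => by positivity) (by simp) fun j => .const_mul hL <|
    (MeanLE.norm_sub_of_center (hx i).aestronglyMeasurable (hv j) (hδ i) (hvδ j)).add <|
      .const_mul zero_le_two (.norm_sub_of_center (hu i) (hu j) (huδ i) (huδ j))

theorem LipschitzCosts.neg_le_cost_sub (hLip : N.LipschitzCosts X' P ξ L)
    (hN : N.IsValid X' κ B P ξ) (hη : 0 < η) (hL : 0 ≤ L) {i : V} {y : F} (hy : y ∈ X')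
    (hsc : StronglyConvexWrt N.O N.X N.ψ η (fun x => N.cost P ξ i x y)) {x p : E} (hx : x ∈ N.X)
    (hp : p ∈ N.X) {g : StrongDual ℝ E} (hg : g ∈ subdiff N.O (fun x => N.cost P ξ i x y) p) :
    -(4 * L ^ 2 / η) ≤ N.cost P ξ i p y - N.cost P ξ i x y := by
  have hpO := hN.subset hp
  have hlip : ∀ z ∈ N.O, |N.cost P ξ i z y - N.cost P ξ i p y| ≤ L * ‖z - p‖ := fun z hz =>
    hLip.lipschitz_own i z hz p hpO y hy
  have hgL : ‖g‖ ≤ L := norm_le_of_mem_subdiff (hN.isOpen.mem_nhds hpO) hL hlip hg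
  have hdist : ‖x - p‖ ≤ 4 * L / η := hsc.norm_sub_le hη hN.differentiable_reg
    hN.strongConvex_reg hx hp (hlip x (hN.subset hx)) hg hgL
  have hcost : N.cost P ξ i x y - N.cost P ξ i p y ≤ 4 * L ^ 2 / η :=
    calc N.cost P ξ i x y - N.cost P ξ i p y ≤ L * ‖x - p‖ :=
          le_of_abs_le (hlip x (hN.subset hx))
      _ ≤ L * (4 * L / η) := by gcongr
      _ = 4 * L ^ 2 / η := by ring
  linarith

theorem IsValid.integrable_avgCost [IsFiniteMeasure P] [FiniteDimensional ℝ E] [MeasurableSpace E]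
    [BorelSpace E] [FiniteDimensional ℝ F] [MeasurableSpace F] [BorelSpace F]
    (hN : N.IsValid X' κ B P ξ) (hX' : IsCompact X') {y : Ω → E} {z : Ω → F} (hy : Measurable y)
    (hz : Measurable z) (hyX : ∀ ω, y ω ∈ N.X) (hzX : ∀ ω, z ω ∈ X') :
    Integrable (fun ω => N.avgCost P ξ (y ω) (z ω)) P := by
  have := FiniteDimensional.proper ℝ E
  have := FiniteDimensional.proper ℝ F
  refine (integrable_finsetSum _ fun i _ => ?_).const_mul _
  obtain ⟨C, hC⟩ := (hN.isCompact.prod hX').exists_bound_of_continuousOn (hN.continuous_cost i)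
  exact (integrable_const C).mono' (measurable_comp_of_continuousOn (hN.continuous_cost i)
    (hy.prodMk hz) fun ω => ⟨hyX ω, hzX ω⟩).aestronglyMeasurable
    (Eventually.of_forall fun ω => hC (y ω, z ω) ⟨hyX ω, hzX ω⟩)

theorem Follows.sum_avgCost_sub_le [MeasurableSpace E] (h : N.Follows ℱ R R' (stepSize η))
    (hN : N.IsValid X' κ B P ξ) (hLip : N.LipschitzCosts X' P ξ L) (hκ : 0 ≤ κ) (hη : 0 < η)
    (hL : 0 ≤ L)
    (hsc : ∀ i, ∀ y ∈ X', StronglyConvexWrt N.O N.X N.ψ η (fun x => N.cost P ξ i x y)) {ω : Ω}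
    (hu : ∀ t i, N.u R' t i ω ∈ X') {x : E} (hx : x ∈ N.X)
    (hconv : ConvexOn ℝ N.X fun y => bregman N.X N.ψ x y)
    (hg : ∀ t i, R.g t i ω ∈ subdiff N.O (fun x => N.cost P ξ i x (N.u R' t i ω)) (N.v R t i ω))
    (i : V) (T : ℕ) :
    ∑ t ∈ Finset.Icc 1 T,
        (N.avgCost P ξ (R.x t i ω) (N.u R' t i ω) - N.avgCost P ξ x (N.u R' t i ω)) ≤
      1 / (Fintype.card V : ℝ) * (Fintype.card V * (4 * L ^ 2 / η) +
        ∑ t ∈ Finset.range (T + 1), ∑ j, (stepSize η t / 2 * ‖R.ghat t j ω‖ ^ 2 +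
          (R.g t j ω - R.ghat t j ω) (N.v R t j ω - x))) +
      ∑ t ∈ Finset.Icc 1 T, N.mismatch R R' L t i ω := by
  have hv := fun t j => hN.v_mem hκ h.x_mem t j ω
  let excess : ℕ → ℝ := fun t =>
    ∑ j, (N.cost P ξ j (N.v R t j ω) (N.u R' t j ω) - N.cost P ξ j x (N.u R' t j ω))
  have hzero : -(Fintype.card V * (4 * L ^ 2 / η)) ≤ excess 0 := by
    calc -(Fintype.card V * (4 * L ^ 2 / η)) = ∑ _j : V, -(4 * L ^ 2 / η) := by simp
      _ ≤ excess 0 := Finset.sum_le_sum fun j _ =>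
        hLip.neg_le_cost_sub hN hη hL (hu 0 j) (hsc j _ (hu 0 j)) hx (hv 0 j) (hg 0 j)
  have hall := h.sum_sum_cost_sub_le hN hκ hη hsc hu hx hconv hg (T + 1)
  have hsplit : ∑ t ∈ Finset.range (T + 1), excess t =
      ∑ t ∈ Finset.Icc 1 T, excess t + excess 0 := by
    rw [Finset.sum_range_succ', sum_Icc_one_eq_sum_range]
  calc _ ≤ ∑ t ∈ Finset.Icc 1 T,
          (1 / (Fintype.card V : ℝ) * excess t + N.mismatch R R' L t i ω) :=
        Finset.sum_le_sum fun t _ => hLip.avgCost_sub_le (h.x_mem t i ω) (hv t) (hu t) hx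
    _ = 1 / (Fintype.card V : ℝ) * ∑ t ∈ Finset.Icc 1 T, excess t +
          ∑ t ∈ Finset.Icc 1 T, N.mismatch R R' L t i ω := by
        rw [Finset.sum_add_distrib, Finset.mul_sum]
    _ ≤ _ := by
        gcongr
        linarith

end Network

end Regret

theorem IsCrossMixing.nonempty {V V' : Type*} [Fintype V'] {edge : ℕ → V' → V → Prop}
    {C : ℕ → Matrix V V' ℝ} (h : IsCrossMixing edge C) (i : V) : Nonempty V' := by
  by_contra hempty
  rw [not_nonempty_iff] at hempty
  simpa using h.row_sum 0 i

section Expectation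

variable {Ω : Type*} [mΩ : MeasurableSpace Ω] {d : ℕ} {E F V V' : Type*}
  [NormedAddCommGroup E] [NormedSpace ℝ E] [NormedAddCommGroup F] [NormedSpace ℝ F]
  [Fintype V] [Fintype V'] {N : Network E F V V' d} {κ : ℝ} {B : ℕ} {P : Measure Ω}
  {ξ : Ω → Fin d → ℝ} {R : Run Ω E V d} {R' : Run Ω F V' d} {ℱ : ℕ → MeasurableSpace Ω}
  {η L ν : ℝ}

theorem pseudoRegret_le_of_forall (hX : N.X.Nonempty) {i : V} {T : ℕ} {c : ℝ}
    (h : ∀ x ∈ N.X, (∫ ω, ∑ t ∈ Finset.Icc 1 T, N.avgCost P ξ (R.x t i ω) (N.u R' t i ω) ∂P) -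
      ∫ ω, ∑ t ∈ Finset.Icc 1 T, N.avgCost P ξ x (N.u R' t i ω) ∂P ≤ c) :
    pseudoRegret N P ξ R R' i T ≤ c :=
  sub_le_comm.1 <| le_csInf (hX.image _) <| Set.forall_mem_image.2 fun x hx =>
    sub_le_comm.1 (h x hx)

variable [IsProbabilityMeasure P] [FiniteDimensional ℝ E] [MeasurableSpace E] [BorelSpace E]
  [FiniteDimensional ℝ F] [MeasurableSpace F] [BorelSpace F]

namespace Network

theorem Follows.integral_sum_avgCost_sub_le {X' : Set F} (h : N.Follows ℱ R R' (stepSize η))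
    (hN : N.IsValid X' κ B P ξ) (hX' : IsCompact X') (hLip : N.LipschitzCosts X' P ξ L)
    (hκ : 0 ≤ κ) (hη : 0 < η) (hL : 0 ≤ L)
    (hsc : ∀ i, ∀ y ∈ X', StronglyConvexWrt N.O N.X N.ψ η (fun x => N.cost P ξ i x y))
    (hu : ∀ t i ω, N.u R' t i ω ∈ X') {x : E} (hx : x ∈ N.X)
    (hconv : ConvexOn ℝ N.X fun y => bregman N.X N.ψ x y)
    (hg : ∀ t j, ∀ᵐ ω ∂P,
      R.g t j ω ∈ subdiff N.O (fun x => N.cost P ξ j x (N.u R' t j ω)) (N.v R t j ω))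
    (hRx : ∀ t i, Measurable (R.x t i)) (hRx' : ∀ t i, Measurable (R'.x t i)) {G : ℝ} {m : ℕ → ℝ}
    (hsq : ∀ t j, MeanLE P (fun ω => ‖R.ghat t j ω‖ ^ 2) (G ^ 2))
    (hnoise : ∀ t j, MeanLE P (fun ω => (R.g t j ω - R.ghat t j ω) (N.v R t j ω - x)) 0)
    {i : V} (hm : ∀ t, MeanLE P (N.mismatch R R' L t i) (m t)) (T : ℕ) :
    (∫ ω, ∑ t ∈ Finset.Icc 1 T, N.avgCost P ξ (R.x t i ω) (N.u R' t i ω) ∂P) -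
        ∫ ω, ∑ t ∈ Finset.Icc 1 T, N.avgCost P ξ x (N.u R' t i ω) ∂P ≤
      4 * L ^ 2 / η + G ^ 2 / 2 * ∑ t ∈ Finset.range (T + 1), stepSize η t +
        ∑ t ∈ Finset.Icc 1 T, m t := by
  have : Nonempty V := ⟨i⟩
  have hcard : (Fintype.card V : ℝ) ≠ 0 := Nat.cast_ne_zero.2 Fintype.card_ne_zero
  have hRu : ∀ t, Measurable (N.u R' t i) := fun t => measurable_sum_smul (hRx' t) (N.C t i)
  have hown := integrable_finsetSum (Finset.Icc 1 T) fun t _ =>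
    hN.integrable_avgCost hX' (hRx t i) (hRu t) (h.x_mem t i) (hu t i)
  have hfixed := integrable_finsetSum (Finset.Icc 1 T) fun t _ =>
    hN.integrable_avgCost hX' measurable_const (hRu t) (fun _ => hx) (hu t i)
  have hbound := ((MeanLE.const (P := P) (Fintype.card V * (4 * L ^ 2 / η))).add
    (.sum fun t (_ : t ∈ Finset.range (T + 1)) => .sum fun j (_ : j ∈ Finset.univ) =>
      ((hsq t j).const_mul (half_pos (stepSize_pos hη t)).le).add (hnoise t j))).const_mul
    (show 0 ≤ 1 / (Fintype.card V : ℝ) by positivity) |>.add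
    (.sum fun t (_ : t ∈ Finset.Icc 1 T) => hm t)
  rw [← integral_sub hown hfixed]
  refine (integral_mono_ae (hown.sub hfixed) hbound.1 ?_).trans (hbound.2.trans_eq ?_)
  · filter_upwards [ae_all_iff.2 fun t => ae_all_iff.2 (hg t)] with ω hω
    simp only [Pi.sub_apply, ← Finset.sum_sub_distrib]
    exact h.sum_avgCost_sub_le hN hLip hκ hη hL hsc (fun t j => hu t j ω) hx hconv hω i T
  · simp only [add_zero, Finset.sum_const, Finset.card_univ, nsmul_eq_mul, ← Finset.mul_sum,
      ← Finset.sum_mul, ← Finset.sum_div]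
    field_simp

variable {N' : Network F E V' V d} {B' : ℕ} {ν' : ℝ}

theorem Follows.pseudoRegret_le_sum (hκ₀ : 0 < κ) (hκ₁ : κ < 1) (hN : N.IsValid N'.X κ B P ξ)
    (hN' : N'.IsValid N.X κ B' P ξ) (hℱ : Monotone ℱ) (hℱ_le : ∀ t, ℱ t ≤ mΩ)
    (hinit : ∀ i, Measurable[ℱ 0] (R.x 0 i)) (hinit' : ∀ i, Measurable[ℱ 0] (R'.x 0 i))
    (hη : 0 < η) (h : N.Follows ℱ R R' (stepSize η)) (h' : N'.Follows ℱ R' R (stepSize η))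
    (hL : 0 ≤ L) (hν : 0 ≤ ν) (hν' : 0 ≤ ν') (hLip : N.LipschitzCosts N'.X P ξ L)
    (hLip' : N'.LipschitzCosts N.X P ξ L) (hor : N.UnbiasedOracle P ξ ℱ R R' ν)
    (hor' : N'.UnbiasedOracle P ξ ℱ R' R ν')
    (hconv : ∀ x ∈ N.X, ConvexOn ℝ N.X fun y => bregman N.X N.ψ x y)
    (hsc : ∀ i, ∀ y ∈ N'.X, StronglyConvexWrt N.O N.X N.ψ η (fun x => N.cost P ξ i x y))
    (i : V) (T : ℕ) :
    pseudoRegret N P ξ R R' i T ≤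
      4 * L ^ 2 / η + (L + ν) ^ 2 / 2 * ∑ t ∈ Finset.range (T + 1), stepSize η t +
        L * (2 * ∑ t ∈ Finset.Icc 1 T,
            disagreement κ (Fintype.card V) B (stepSize η) (Lam P R) (L + ν) t +
          4 * ∑ t ∈ Finset.Icc 1 T,
            disagreement κ (Fintype.card V') B' (stepSize η) (Lam P R') (L + ν') t) := by
  have hα := fun t => (stepSize_pos hη t).le
  have hv := hN.v_mem hκ₀.le h.x_mem
  have hu := hN.u_mem hN'.convex h'.x_mem
  have hx := h.measurable_x hN hκ₀.le hℱ hinit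
  have hRx := fun t i => (hx t i).mono (hℱ_le t) le_rfl
  have hRx' := fun t i => (h'.measurable_x hN' hκ₀.le hℱ hinit' t i).mono (hℱ_le t) le_rfl
  have hg := fun t j => hor.ae_norm_g_le hN hLip hL t j (hv t j) (hu t j)
  have hg' := fun t j => hor'.ae_norm_g_le hN' hLip' hL t j (hN'.v_mem hκ₀.le h'.x_mem t j)
    (hN'.u_mem hN.convex h.x_mem t j)
  have hδ := h.meanLE_norm_x_sub_mean hN hκ₀ hκ₁ hα hRx fun t j =>
    hor.meanLE_norm_ghat hℱ_le hL hν (hg t j)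
  have hδ' := h'.meanLE_norm_x_sub_mean hN' hκ₀ hκ₁ hα hRx' fun t j =>
    hor'.meanLE_norm_ghat hℱ_le hL hν' (hg' t j)
  obtain ⟨ω₀⟩ := nonempty_of_isProbabilityMeasure P
  refine pseudoRegret_le_of_forall ⟨_, h.init_mem i ω₀⟩ fun x hxX => ?_
  obtain ⟨C, hC⟩ := hN.isCompact.exists_bound_of_continuousOn (f := fun y => y - x) (by fun_prop)
  refine (h.integral_sum_avgCost_sub_le hN hN'.isCompact hLip hκ₀.le hη hL hsc hu hxX
    (hconv x hxX) hor.g_mem hRx hRx'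
    (fun t j => hor.meanLE_sq_norm_ghat hℱ_le hL hν (hg t j))
    (fun t j => hor.meanLE_noise_apply hℱ_le t j
      ((measurable_sum_smul (hx t) (N.W t j)).sub_const x) fun ω => hC _ (hv t j ω))
    (fun t => hN.meanLE_mismatch hκ₀.le hL (hRx t) (hRx' t) (hδ t) (hδ' t) i) T).trans_eq ?_
  simp only [← Finset.mul_sum, Finset.sum_add_distrib]
  ring

end Network

end Expectation

section Rate

variable {κ η L ν : ℝ} {n B : ℕ}

theorem constCoeff_add_mul (Λ G r κ : ℝ) (n B : ℕ) :
    constCoeff (Λ + G * r) κ n B = constCoeff Λ κ n B + r * constCoeff G κ n B := by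
  unfold constCoeff
  ring

theorem logCoeff_eq (L ν κ : ℝ) (n B : ℕ) :
    logCoeff L ν κ n B = (L + ν) * (9 * L + ν) + 4 * L * constCoeff (L + ν) κ n B := by
  unfold logCoeff constCoeff
  ring

theorem constCoeff_nonneg (hκ₀ : 0 < κ) (hκ₁ : κ < 1) (hn : n ≠ 0) (hB : 1 ≤ B) {Λ : ℝ}
    (hΛ : 0 ≤ Λ) : 0 ≤ constCoeff Λ κ n B :=
  div_nonneg (mul_nonneg (mul_nonneg n.cast_nonneg (Gam_pos hκ₁ hn).le) hΛ)
    (sub_nonneg.2 (theta_lt_one hκ₀ hκ₁ hn hB).le)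

theorem sum_stepSize_le (hη : 0 < η) (T : ℕ) :
    ∑ t ∈ Finset.range T, stepSize η t ≤ 1 / η * (1 + Real.log T) :=
  calc ∑ t ∈ Finset.range T, stepSize η t = 1 / η * ∑ t ∈ Finset.range T, 1 / ((t : ℝ) + 1) := by
        simp only [stepSize, Finset.mul_sum, one_div_mul_one_div]
    _ ≤ 1 / η * (1 + Real.log T) := by
        gcongr
        exact sum_inv_succ_le T

theorem one_div_le_mul_one_add_log (hη : 0 < η) (T : ℕ) : 1 / η ≤ 1 / η * (1 + Real.log T) :=
  le_mul_of_one_le_right (one_div_pos.2 hη).le (le_add_of_nonneg_right (Real.log_natCast_nonneg T))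

theorem sum_stepSize_succ_le (hη : 0 < η) (T : ℕ) :
    ∑ t ∈ Finset.range (T + 1), stepSize η t ≤ 2 * (1 / η * (1 + Real.log T)) := by
  have hlast : stepSize η T ≤ 1 / η :=
    one_div_le_one_div_of_le hη (le_mul_of_one_le_right hη.le (by simp))
  rw [Finset.sum_range_succ]
  linarith [sum_stepSize_le hη T, one_div_le_mul_one_add_log hη T]

theorem sum_disagreement_stepSize_le (hκ₀ : 0 < κ) (hκ₁ : κ < 1) (hn : n ≠ 0) (hB : 1 ≤ B)
    (hη : 0 < η) {Λ G : ℝ} (hΛ : 0 ≤ Λ) (hG : 0 ≤ G) (T : ℕ) :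
    ∑ t ∈ Finset.Icc 1 T, disagreement κ n B (stepSize η) Λ G t ≤
      constCoeff Λ κ n B + 1 / η * (1 + Real.log T) * constCoeff G κ n B := by
  refine (sum_disagreement_le hκ₀ hκ₁ hn hB (fun t => (stepSize_pos hη t).le) hΛ hG T).trans ?_
  rw [constCoeff_add_mul]
  gcongr
  · exact constCoeff_nonneg hκ₀ hκ₁ hn hB hG
  · exact sum_stepSize_le hη T

theorem exists_add_le_mul_log (A D : ℝ) :
    ∃ K : ℝ, ∀ T : ℕ, 2 ≤ T → A * (1 + Real.log T) + D ≤ K * Real.log T := by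
  refine ⟨A + |A + D| / Real.log 2, fun T hT => ?_⟩
  have hlog₂ : 0 < Real.log 2 := Real.log_pos one_lt_two
  have hlog : Real.log 2 ≤ Real.log T := Real.log_le_log two_pos (mod_cast hT)
  calc A * (1 + Real.log T) + D ≤ A * Real.log T + |A + D| := by linarith [le_abs_self (A + D)]
    _ = A * Real.log T + |A + D| / Real.log 2 * Real.log 2 := by
        rw [div_mul_cancel₀ _ hlog₂.ne']
    _ ≤ A * Real.log T + |A + D| / Real.log 2 * Real.log T := by gcongr
    _ = (A + |A + D| / Real.log 2) * Real.log T := by ring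

theorem sum_le_logCoeff_constCoeff {ν' : ℝ} {n' B' : ℕ} (hκ₀ : 0 < κ) (hκ₁ : κ < 1) (hn : n ≠ 0)
    (hn' : n' ≠ 0) (hB : 1 ≤ B) (hB' : 1 ≤ B') (hη : 0 < η) (hL : 0 ≤ L) (hν : 0 ≤ ν)
    (hν' : 0 ≤ ν') {Λ Λ' : ℝ} (hΛ : 0 ≤ Λ) (hΛ' : 0 ≤ Λ') (T : ℕ) :
    4 * L ^ 2 / η + (L + ν) ^ 2 / 2 * ∑ t ∈ Finset.range (T + 1), stepSize η t +
        L * (2 * ∑ t ∈ Finset.Icc 1 T, disagreement κ n B (stepSize η) Λ (L + ν) t +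
          4 * ∑ t ∈ Finset.Icc 1 T, disagreement κ n' B' (stepSize η) Λ' (L + ν') t) ≤
      1 / η * (logCoeff L ν κ n B + logCoeff L ν' κ n' B') * (1 + Real.log T) +
        4 * L * (constCoeff Λ κ n B + constCoeff Λ' κ n' B') := by
  have hG := add_nonneg hL hν
  have hG' := add_nonneg hL hν'
  have hΛcoeff := constCoeff_nonneg hκ₀ hκ₁ hn hB hΛ
  have hGcoeff := constCoeff_nonneg hκ₀ hκ₁ hn hB hG
  have hr : 1 / η ≤ 1 / η * (1 + Real.log T) := one_div_le_mul_one_add_log hη T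
  have hα := sum_stepSize_succ_le hη T
  have hδ := sum_disagreement_stepSize_le hκ₀ hκ₁ hn hB hη hΛ hG T
  have hδ' := sum_disagreement_stepSize_le hκ₀ hκ₁ hn' hB' hη hΛ' hG' T
  rw [logCoeff_eq, logCoeff_eq, mul_right_comm, div_eq_mul_one_div]
  have hr₀ : 0 ≤ 1 / η * (1 + Real.log T) := (one_div_pos.2 hη).le.trans hr
  generalize 1 / η * (1 + Real.log T) = r at *
  calc _ ≤ 4 * L ^ 2 * r + (L + ν) ^ 2 / 2 * (2 * r) +
        L * (2 * (constCoeff Λ κ n B + r * constCoeff (L + ν) κ n B) +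
          4 * (constCoeff Λ' κ n' B' + r * constCoeff (L + ν') κ n' B')) := by gcongr
    _ ≤ _ + (r * (4 * L ^ 2 + 8 * (L * ν)) + r * ((L + ν') * (9 * L + ν')) +
        2 * (L * constCoeff Λ κ n B) + 2 * (r * (L * constCoeff (L + ν) κ n B))) :=
      le_add_of_nonneg_right (by positivity)
    _ = _ := by ring

end Rate

end DSMD

theorem theorem3_general {Ω : Type*} [mΩ : MeasurableSpace Ω] {P : Measure Ω}
    [IsProbabilityMeasure P] {E₁ E₂ V₁ V₂ : Type*}
    [NormedAddCommGroup E₁] [NormedSpace ℝ E₁] [FiniteDimensional ℝ E₁]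
    [MeasurableSpace E₁] [BorelSpace E₁]
    [NormedAddCommGroup E₂] [NormedSpace ℝ E₂] [FiniteDimensional ℝ E₂]
    [MeasurableSpace E₂] [BorelSpace E₂] [Fintype V₁] [Fintype V₂] {d : ℕ} {ξ : Ω → Fin d → ℝ}
    {N₁ : DSMD.Network E₁ E₂ V₁ V₂ d} {N₂ : DSMD.Network E₂ E₁ V₂ V₁ d}
    {κ : ℝ} (hκ₀ : 0 < κ) (hκ₁ : κ < 1) {B₁ B₂ : ℕ}
    (hN₁ : N₁.IsValid N₂.X κ B₁ P ξ) (hN₂ : N₂.IsValid N₁.X κ B₂ P ξ) {η : ℝ} (hη : 0 < η)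
    {R₁ : DSMD.Run Ω E₁ V₁ d} {R₂ : DSMD.Run Ω E₂ V₂ d} {ℱ : ℕ → MeasurableSpace Ω}
    (hℱ : Monotone ℱ) (hℱ_le : ∀ t, ℱ t ≤ mΩ)
    (hinit₁ : ∀ i, Measurable[ℱ 0] (R₁.x 0 i)) (hinit₂ : ∀ i, Measurable[ℱ 0] (R₂.x 0 i))
    (hR₁ : N₁.Follows ℱ R₁ R₂ (DSMD.stepSize η)) (hR₂ : N₂.Follows ℱ R₂ R₁ (DSMD.stepSize η))
    {L ν₁ ν₂ : ℝ} (hL : 0 ≤ L) (hν₁ : 0 ≤ ν₁) (hν₂ : 0 ≤ ν₂)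
    (hLip₁ : N₁.LipschitzCosts N₂.X P ξ L) (hLip₂ : N₂.LipschitzCosts N₁.X P ξ L)
    (hor₁ : N₁.UnbiasedOracle P ξ ℱ R₁ R₂ ν₁) (hor₂ : N₂.UnbiasedOracle P ξ ℱ R₂ R₁ ν₂)
    (hconv : ∀ x ∈ N₁.X, ConvexOn ℝ N₁.X fun y => DSMD.bregman N₁.X N₁.ψ x y)
    (hsc : ∀ i, ∀ x₂ ∈ N₂.X,
      DSMD.StronglyConvexWrt N₁.O N₁.X N₁.ψ η (fun x₁ => N₁.cost P ξ i x₁ x₂)) :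
    (∀ i : V₁, ∀ T : ℕ, 1 ≤ T →
      DSMD.pseudoRegret N₁ P ξ R₁ R₂ i T ≤
        (1 / η) * (DSMD.logCoeff L ν₁ κ (Fintype.card V₁) B₁ +
            DSMD.logCoeff L ν₂ κ (Fintype.card V₂) B₂) * (1 + Real.log T) +
          4 * L * (DSMD.constCoeff (DSMD.Lam P R₁) κ (Fintype.card V₁) B₁ +
            DSMD.constCoeff (DSMD.Lam P R₂) κ (Fintype.card V₂) B₂)) ∧
    ∃ K : ℝ, ∀ i : V₁, ∀ T : ℕ, 2 ≤ T →
      DSMD.pseudoRegret N₁ P ξ R₁ R₂ i T ≤ K * Real.log T :=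
  have hbound (i : V₁) (T : ℕ) :=
    have : Nonempty V₁ := ⟨i⟩
    have : Nonempty V₂ := hN₁.crossMixing.nonempty i
    (hR₁.pseudoRegret_le_sum hκ₀ hκ₁ hN₁ hN₂ hℱ hℱ_le hinit₁ hinit₂ hη hR₂ hL hν₁ hν₂ hLip₁ hLip₂
      hor₁ hor₂ hconv hsc i T).trans <|
      DSMD.sum_le_logCoeff_constCoeff hκ₀ hκ₁ Fintype.card_ne_zero Fintype.card_ne_zero
        hN₁.mixing.one_le hN₂.mixing.one_le hη hL hν₁ hν₂ (DSMD.Lam_nonneg P R₁)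
        (DSMD.Lam_nonneg P R₂) T
  ⟨fun i T _ => hbound i T, (DSMD.exists_add_le_mul_log _ _).imp fun _ hK i T hT =>
    (hbound i T).trans (hK T hT)⟩

theorem theorem3 {Ω : Type*} [MeasurableSpace Ω] (P : Measure Ω) [IsProbabilityMeasure P]
    {E₁ E₂ V₁ V₂ : Type*}
    [NormedAddCommGroup E₁] [NormedSpace ℝ E₁] [FiniteDimensional ℝ E₁]
    [MeasurableSpace E₁] [BorelSpace E₁]
    [NormedAddCommGroup E₂] [NormedSpace ℝ E₂] [FiniteDimensional ℝ E₂]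
    [MeasurableSpace E₂] [BorelSpace E₂]
    [Fintype V₁] [Nonempty V₁] [Fintype V₂] [Nonempty V₂]
    {d : ℕ} (ξ : Ω → Fin d → ℝ) (hξ : Measurable ξ)
    -- the game: two networks with opposite average costs
    (N₁ : DSMD.Network E₁ E₂ V₁ V₂ d) (N₂ : DSMD.Network E₂ E₁ V₂ V₁ d)
    (κ : ℝ) (hκ₀ : 0 < κ) (hκ₁ : κ < 1) (B₁ B₂ : ℕ)
    (hN₁ : N₁.IsValid N₂.X κ B₁ P ξ) (hN₂ : N₂.IsValid N₁.X κ B₂ P ξ)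
    (hzero : ∀ x₁ ∈ N₁.X, ∀ x₂ ∈ N₂.X, N₁.avgCost P ξ x₁ x₂ = -N₂.avgCost P ξ x₂ x₁)
    -- the algorithm with step sizes `1 / (η (t + 1))`
    (η : ℝ) (hη : 0 < η)
    (R₁ : DSMD.Run Ω E₁ V₁ d) (R₂ : DSMD.Run Ω E₂ V₂ d)
    (hiid : DSMD.IsIIDSample P ξ R₁ R₂)
    (hR₁ : N₁.Follows (DSMD.past R₁ R₂) R₁ R₂ (DSMD.stepSize η))
    (hR₂ : N₂.Follows (DSMD.past R₁ R₂) R₂ R₁ (DSMD.stepSize η))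
    -- Lipschitz costs, unbiased subgradients with bounded variance, regular divergences
    (L ν₁ ν₂ : ℝ) (hL : 0 < L) (hν₁ : 0 < ν₁) (hν₂ : 0 < ν₂)
    (hLip₁ : N₁.LipschitzCosts N₂.X P ξ L) (hLip₂ : N₂.LipschitzCosts N₁.X P ξ L)
    (hor₁ : N₁.UnbiasedOracle P ξ (DSMD.past R₁ R₂) R₁ R₂ ν₁)
    (hor₂ : N₂.UnbiasedOracle P ξ (DSMD.past R₁ R₂) R₂ R₁ ν₂)
    (hdiv₁ : N₁.RegularDivergence) (hdiv₂ : N₂.RegularDivergence)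
    -- generalized strong convexity of the costs of the first network
    (hsc : ∀ i, ∀ x₂ ∈ N₂.X,
      DSMD.StronglyConvexWrt N₁.O N₁.X N₁.ψ η (fun x₁ => N₁.cost P ξ i x₁ x₂)) :
    (∀ i : V₁, ∀ T : ℕ, 1 ≤ T →
      DSMD.pseudoRegret N₁ P ξ R₁ R₂ i T ≤
        (1 / η) * (DSMD.logCoeff L ν₁ κ (Fintype.card V₁) B₁ +
            DSMD.logCoeff L ν₂ κ (Fintype.card V₂) B₂) * (1 + Real.log T) +
          4 * L * (DSMD.constCoeff (DSMD.Lam P R₁) κ (Fintype.card V₁) B₁ +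
            DSMD.constCoeff (DSMD.Lam P R₂) κ (Fintype.card V₂) B₂)) ∧
    ∃ K : ℝ, ∀ i : V₁, ∀ T : ℕ, 2 ≤ T →
      DSMD.pseudoRegret N₁ P ξ R₁ R₂ i T ≤ K * Real.log T :=
  theorem3_general hκ₀ hκ₁ hN₁ hN₂ hη DSMD.past_mono
    (DSMD.past_le hR₁.measurable_init hR₂.measurable_init hiid.measurable hiid.measurable')
    DSMD.measurable_past_init DSMD.measurable_past_init' hR₁ hR₂ hL.le hν₁.le hν₂.le hLip₁ hLip₂
    hor₁ hor₂ hdiv₁.convex_right hsc
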